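/- **Conventions.** Categories are locally small and possibly large. *The pseudomonad $\boldsymbol\beta$.* For a category $C$, the category $\boldsymbol\beta C$ has as objects the triples $(X,h,\nu)$ of a set $X$, a family $h=(h_x)_{x\in X}$ of objects of $C$ and an ultrafilter $\nu$ on $X$. A morphism $(X,h,\nu)\to(X',h',\nu')$ is given by a map $g\colon X'\to X$ with $g_*\nu'=\nu$ and morphisms $\alpha_{x}\colon h_{g(x)}\to h'_{x}$ for all $x\in X'$, and two such pairs are identified when they agree on a set in $\nu'$. The unit $\eta$ sends $c$ to the family $c$ indexed by the one-point set; the multiplication $\mu$ sends a family $(Y_x,k_x,\xi_x)_{x\in X}$ with ultrafilter $\nu$ to the family indexed by $\sum_x Y_x$ with the direct sum $\sum_{x:\nu}\xi_x$. *Its extension.* A profunctor from $C$ to $D$ is a functor $F\colon D^{op}\times C\to\mathrm{Set}$, profunctors are composed by coends, and a functor $f\colon C\to D$ induces $f_\diamond=D(-,f-)$ from $C$ to $D$ and $f^\diamond=D(f-,-)$ from $D$ to $C$. If $R$ is the category of elements of $F$, with projections $\mathrm{dom}\colon R\to D$ and $\mathrm{cod}\colon R\to C$, then $\underline{\boldsymbol\beta}F=(\boldsymbol\beta\,\mathrm{dom})_\diamond\circ(\boldsymbol\beta\,\mathrm{cod})^\diamond$,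 from $\boldsymbol\beta C$ to $\boldsymbol\beta D$. Equivalently, $\underline{\boldsymbol\beta}F((X,h,\nu),(Y,k,\xi))$ is the set of pairs of a map $g\colon Y\to X$ with $g_*\xi=\nu$ and a family of elements of $F(h_{g(y)},k_y)$, $y\in Y$, modulo agreement on a set in $\xi$. *Lax algebras.* A lax $\underline{\boldsymbol\beta}$-algebra is a category $A_0$ with a profunctor $A$ from $\boldsymbol\beta A_0$ to $A_0$ and natural transformations $\Gamma\colon 1\Rightarrow A\circ\eta_\diamond$ and $\Delta\colon A\circ\underline{\boldsymbol\beta}A\Rightarrow A\circ\mu_\diamond$ that satisfy the usual two unit axioms and the associativity axiom. A representable colax morphism $A\to A'$ is a functor $f\colon A_0\to A_0'$ with a natural transformation $\Theta\colon f_\diamond\circ A\Rightarrow A'\circ\underline{\boldsymbol\beta}(f_\diamond)=A'\circ(\boldsymbol\beta f)_\diamond$ compatible with the $\Gamma$'s and $\Delta$'s; it induces maps $A(a,p)\to A'(f a,(\boldsymbol\beta f)p)$. The category of points $\mathrm{pt}(A)$ has the objects of $A_0$, the sets $A(a,\eta a')$ as sets of morphisms $a\to a'$, the identities $\Gamma(1_a)$,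 and the composition given by $\Delta$; it acts on the sets $A(-,p)$, so these are presheaves on $\mathrm{pt}(A)$. The comparison functor $\gamma\colon A_0\to\mathrm{pt}(A)$ is the identity on objects and $\Gamma$ on morphisms. The lax algebra is *discrete* if the category $A_0$ is discrete, and *normalized* if $\gamma$ is fully faithful. An isomorphism of lax algebras with the same class of objects $X$ is *over $X$* if it is the identity on objects. A presheaf is small if it is a (set-indexed) small colimit of representable presheaves. A lax algebra is *small* if all presheaves $A(-,p)$ on $A_0$ are small, and *small over its points* if all presheaves $A(-,p)$ on $\mathrm{pt}(A)$ are small. Smallness is assumed only where it is mentioned. **Proposition.** There are * for every class $X$, a bijection $b_X$ between the discrete lax $\underline{\boldsymbol\beta}$-algebras with class of objects $X$, up to isomorphism over $X$, and the normalized ones with class of objects $X$, up to isomorphism over $X$; * an equivalence $E$ from the category of discrete lax algebras to the category of normalized lax algebras, both with representable colax morphisms; * representable colax morphisms $\varphi_D\colon D\to E(D)$, natural in the discrete lax algebra $D$, such that 1. $b_X[D]=[N]$ if and only if there is a representable colax morphism $D\to N$ that is the identity on objects and bijective on all sets $D(a,p)\to N(a,p)$; 2. $E$ extends the bijections: if $D$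 has class of objects $X$, then so does $E(D)$, and $b_X[D]=[E(D)]$; 3. every $\varphi_D$ is bijective on objects and on all sets of elements of the profunctors; 4. the correspondence matches smallness: if $D$ is discrete, $N$ is normalized, and $\psi\colon D\to N$ is a representable colax morphism that is bijective on objects and on all sets of elements of the profunctors, then $N$ is small if and only if $D$ is small over its points. This is the case when $D$ is small, and $D$ is always small if its objects form a set. -/

import Mathlib

open CategoryTheory Opposite

universe u v v₁ v₂ w w₁ w₂ w₃

/-- An object of `𝛃 C`: a set `idx`, a family of objects of `C` indexed by it, and an
ultrafilter on it. -/
structure UltraFamily (C : Type v) : Type (max (u + 1) v) where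
  idx : Type u
  fam : idx → C
  ult : Ultrafilter idx

namespace UltraFamily

/-- Apply a function to the members of a family. -/
abbrev map {C : Type v} {D : Type v₁} (f : C → D) (p : UltraFamily.{u} C) : UltraFamily.{u} D where
  idx := p.idx
  fam x := f (p.fam x)
  ult := p.ult

/-- The family `c` indexed by the one-point set. -/
abbrev pure {C : Type v} (c : C) : UltraFamily.{u} C where
  idx := PUnit
  fam _ := c
  ult := Pure.pure PUnit.unit

/-- The flattening of a family of families, indexed by the disjoint union and with the direct sum
`∑_{x : ν} ξ_x` of the ultrafilters. -/
abbrev sum {C : Type v} (P : UltraFamily.{u} (UltraFamily.{u} C)) : UltraFamily.{u} C where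
  idx := Σ x : P.idx, (P.fam x).idx
  fam z := (P.fam z.1).fam z.2
  ult := P.ult.bind fun x => (P.fam x).ult.map (Sigma.mk x)

theorem mem_sum_ult {C : Type v} (P : UltraFamily.{u} (UltraFamily.{u} C))
    (S : Set (Σ x : P.idx, (P.fam x).idx)) :
    S ∈ P.sum.ult ↔ {x | {z | (⟨x, z⟩ : Σ x : P.idx, (P.fam x).idx) ∈ S} ∈ (P.fam x).ult} ∈ P.ult :=
  Iff.rfl

end UltraFamily

section Germs

variable {C : Type v} {D : Type v₁} {E : Type v₂}

/-- Given sets `F d c`: a reindexing `g : q.idx → p.idx` with `g_* (q.ult) = p.ult`, and an element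
of `F (p_{g y}) (q_y)` for every `y`. -/
structure GermRep (F : D → C → Type w) (p : UltraFamily.{u} D) (q : UltraFamily.{u} C) :
    Type (max u w) where
  reindex : q.idx → p.idx
  ult_map : q.ult.map reindex = p.ult
  val : ∀ y, F (p.fam (reindex y)) (q.fam y)

namespace GermRep

variable {F : D → C → Type w} {p : UltraFamily.{u} D} {q : UltraFamily.{u} C}

/-- The value at `y`, together with the index `g y`. -/
def pt (s : GermRep F p q) (y : q.idx) : Σ x : p.idx, F (p.fam x) (q.fam y) :=
  ⟨s.reindex y, s.val y⟩

/-- Agreement almost everywhere. -/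
instance setoid (F : D → C → Type w) (p : UltraFamily.{u} D) (q : UltraFamily.{u} C) :
    Setoid (GermRep F p q) where
  r s t := ∀ᶠ y in (q.ult : Filter q.idx), s.pt y = t.pt y
  iseqv :=
    { refl := fun _ => Filter.Eventually.of_forall fun _ => rfl
      symm := fun h => h.mono fun _ h => h.symm
      trans := fun h h' => by filter_upwards [h, h'] with y h h' using h.trans h' }

theorem mem_ult (s : GermRep F p q) (A : Set p.idx) : A ∈ p.ult ↔ s.reindex ⁻¹' A ∈ q.ult := by
  rw [← Ultrafilter.mem_map, s.ult_map]

end GermRep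

/-- The `GermRep`s modulo agreement almost everywhere. -/
def Germ (F : D → C → Type w) (p : UltraFamily.{u} D) (q : UltraFamily.{u} C) :
    Type (max u w) :=
  Quotient (GermRep.setoid F p q)

namespace Germ

def mk {F : D → C → Type w} {p : UltraFamily.{u} D} {q : UltraFamily.{u} C}
    (s : GermRep F p q) : Germ F p q := Quotient.mk _ s

variable {F : D → C → Type w} {p : UltraFamily.{u} D} {q : UltraFamily.{u} C}

theorem mk_eq {s t : GermRep F p q}
    (h : ∀ᶠ y in (q.ult : Filter q.idx), s.pt y = t.pt y) : mk s = mk t := Quotient.sound h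

theorem mk_eq' {s t : GermRep F p q} (h : ∀ y, s.pt y = t.pt y) : mk s = mk t :=
  mk_eq (Filter.Eventually.of_forall h)

theorem mk_congr {g : q.idx → p.idx} {hg hg' : q.ult.map g = p.ult}
    {a b : ∀ y, F (p.fam (g y)) (q.fam y)} (h : ∀ y, a y = b y) :
    mk ⟨g, hg, a⟩ = mk ⟨g, hg', b⟩ := by
  obtain rfl : a = b := funext h
  rfl

theorem mk_eq_iff {s t : GermRep F p q} :
    mk s = mk t ↔ ∀ᶠ y in (q.ult : Filter q.idx), s.pt y = t.pt y := Quotient.eq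

theorem exists_rep (g : Germ F p q) : ∃ s, mk s = g := Quotient.exists_rep g

def lift {T : Sort*} (f : GermRep F p q → T)
    (h : ∀ s t, (∀ᶠ y in (q.ult : Filter q.idx), s.pt y = t.pt y) → f s = f t) (g : Germ F p q) : T :=
  Quotient.lift f h g

noncomputable def out (g : Germ F p q) : GermRep F p q := Quotient.out g

theorem mk_out (g : Germ F p q) : mk g.out = g := Quotient.out_eq g

/-- Apply `m` to all values. -/
def map {C' : Type*} {D' : Type*} {G : D' → C' → Type w₁} (f : D → D') (g : C → C')
    (m : ∀ d c, F d c → G (f d) (g c)) : Germ F p q → Germ G (p.map f) (q.map g) :=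
  lift (fun s => mk ⟨s.reindex, s.ult_map, fun y => m _ _ (s.val y)⟩) fun s t h => mk_eq <| by
    filter_upwards [h] with y h
    exact congrArg (fun z : Σ x : p.idx, F (p.fam x) (q.fam y) =>
      (⟨z.1, m _ _ z.2⟩ : Σ x : p.idx, G (f (p.fam x)) (g (q.fam y)))) h

/-- Composition of reindexings, the values being composed by `m`. -/
def comp {G : E → D → Type w₁} {H : E → C → Type w₂} {o : UltraFamily.{u} E}
    (m : ∀ e d c, G e d → F d c → H e c) (a : Germ G o p) (b : Germ F p q) : Germ H o q :=
  lift (fun s => lift (fun t => mk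
    { reindex := fun y => s.reindex (t.reindex y)
      ult_map := by rw [← s.ult_map, ← t.ult_map, Ultrafilter.map_map]; rfl
      val := fun y => m _ _ _ (s.val (t.reindex y)) (t.val y) })
    fun t t' h => mk_eq <| by
      filter_upwards [h] with y h
      exact congrArg (fun z : Σ x : p.idx, F (p.fam x) (q.fam y) =>
        (⟨s.reindex z.1, m _ _ _ (s.val z.1) z.2⟩ : Σ x : o.idx, H (o.fam x) (q.fam y))) h)
    (fun s s' h => funext fun b => by
      obtain ⟨t, rfl⟩ := exists_rep b
      refine mk_eq ?_
      have h' : {x | s.pt x = s'.pt x} ∈ p.ult := h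
      rw [t.mem_ult] at h'
      filter_upwards [h'] with y h
      exact congrArg (fun z : Σ x : o.idx, G (o.fam x) (p.fam (t.reindex y)) =>
        (⟨z.1, m _ _ _ z.2 (t.val y)⟩ : Σ x : o.idx, H (o.fam x) (q.fam y))) h) a b

/-- The germ of one element. -/
def pure {d : D} {c : C} (x : F d c) :
    Germ F (UltraFamily.pure.{u} d) (UltraFamily.pure.{u} c) :=
  mk ⟨fun _ => PUnit.unit, Ultrafilter.map_pure _ _, fun _ => x⟩

/-- Flattening of representatives: reindexing `(y, z) ↦ (g y, g_y z)`. -/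
def sumRep {P : UltraFamily.{u} (UltraFamily.{u} D)} {Q : UltraFamily.{u} (UltraFamily.{u} C)}
    (g : Q.idx → P.idx) (hg : Q.ult.map g = P.ult)
    (s : ∀ y, GermRep F (P.fam (g y)) (Q.fam y)) : GermRep F P.sum Q.sum where
  reindex z := ⟨g z.1, (s z.1).reindex z.2⟩
  ult_map := by
    apply Ultrafilter.coe_injective
    ext S
    change _ ∈ Q.sum.ult ↔ S ∈ P.sum.ult
    rw [UltraFamily.mem_sum_ult, UltraFamily.mem_sum_ult, ← hg, Ultrafilter.mem_map]
    refine iff_of_eq (congrArg (· ∈ Q.ult) (Set.ext fun y => ?_))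
    exact ((s y).mem_ult {z | (⟨g y, z⟩ : Σ x : P.idx, (P.fam x).idx) ∈ S}).symm
  val z := (s z.1).val z.2

theorem mk_sumRep_eq {P : UltraFamily.{u} (UltraFamily.{u} D)}
    {Q : UltraFamily.{u} (UltraFamily.{u} C)}
    {g g' : Q.idx → P.idx} {hg : Q.ult.map g = P.ult} {hg' : Q.ult.map g' = P.ult}
    {s : ∀ y, GermRep F (P.fam (g y)) (Q.fam y)} {s' : ∀ y, GermRep F (P.fam (g' y)) (Q.fam y)}
    (h : ∀ᶠ y in (Q.ult : Filter Q.idx),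
      (⟨g y, mk (s y)⟩ : Σ x, Germ F (P.fam x) (Q.fam y)) = ⟨g' y, mk (s' y)⟩) :
    mk (sumRep g hg s) = mk (sumRep g' hg' s') := by
  apply mk_eq
  change _ ∈ Q.sum.ult
  rw [Q.mem_sum_ult]
  filter_upwards [h] with y h
  have key : ∀ (x x' : P.idx) (a : GermRep F (P.fam x) (Q.fam y))
      (b : GermRep F (P.fam x') (Q.fam y)),
      (⟨x, mk a⟩ : Σ x, Germ F (P.fam x) (Q.fam y)) = ⟨x', mk b⟩ →
      {z | (⟨⟨x, a.reindex z⟩, a.val z⟩ : Σ x : Σ x : P.idx, (P.fam x).idx,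
        F ((P.fam x.1).fam x.2) ((Q.fam y).fam z)) = ⟨⟨x', b.reindex z⟩, b.val z⟩} ∈
          (Q.fam y).ult := by
    intro x x' a b hab
    obtain ⟨h1, h2⟩ := Sigma.mk.inj hab
    subst h1
    filter_upwards [mk_eq_iff.1 (eq_of_heq h2)] with z hz
    exact congrArg (fun t : Σ z' : (P.fam x).idx, F ((P.fam x).fam z') ((Q.fam y).fam z) =>
      (⟨⟨x, t.1⟩, t.2⟩ : Σ x : Σ x : P.idx, (P.fam x).idx,
        F ((P.fam x.1).fam x.2) ((Q.fam y).fam z))) hz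
  exact key _ _ _ _ h

/-- Flattening of germs of germs; it does not depend on the representatives, by `sum_mk`. -/
noncomputable def sum {P : UltraFamily.{u} (UltraFamily.{u} D)}
    {Q : UltraFamily.{u} (UltraFamily.{u} C)} :
    Germ (fun p q => Germ F p q) P Q → Germ F P.sum Q.sum :=
  lift (fun s => mk (sumRep s.reindex s.ult_map fun y => (s.val y).out))
    fun s t h => mk_sumRep_eq <| by
      filter_upwards [h] with y h
      simp only [mk_out]
      exact h

theorem sum_mk {P : UltraFamily.{u} (UltraFamily.{u} D)}
    {Q : UltraFamily.{u} (UltraFamily.{u} C)} (g : Q.idx → P.idx) (hg : Q.ult.map g = P.ult)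
    (s : ∀ y, GermRep F (P.fam (g y)) (Q.fam y)) :
    sum (mk ⟨g, hg, fun y => mk (s y)⟩ : Germ (fun p q => Germ F p q) P Q) =
      mk (sumRep g hg s) :=
  mk_sumRep_eq <| Filter.Eventually.of_forall fun y => by rw [mk_out]

end Germ
end Germs

/-- The sets of morphisms of a category. -/
abbrev homEl (C : Type v) [Category.{w} C] : C → C → Type w := fun c d => c ⟶ d

namespace UltraFamily

variable {C : Type v} [Category.{u} C] {D : Type v₁} [Category.{u} D]

/-- A morphism `p ⟶ q` of `𝛃 C`: a map of index sets in the opposite direction that carries `q.ult`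
to `p.ult`, and morphisms `p_{g y} ⟶ q_y`, modulo agreement almost everywhere. -/
abbrev HomGerm (p q : UltraFamily.{u} C) : Type u := Germ (homEl C) p q

instance categoryStruct : CategoryStruct.{u} (UltraFamily.{u} C) where
  Hom p q := HomGerm p q
  id p := Germ.mk ⟨id, Ultrafilter.map_id _, fun y => 𝟙 (p.fam y)⟩
  comp {p q r} (f : HomGerm p q) (g : HomGerm q r) :=
    (Germ.comp (G := homEl C) (F := homEl C) (H := homEl C) (fun _ _ _ a b => a ≫ b) f g :
      HomGerm p r)

theorem exists_rep {p q : UltraFamily.{u} C} (f : p ⟶ q) :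
    ∃ s : GermRep (homEl C) p q, (Germ.mk s : HomGerm p q) = f :=
  Germ.exists_rep (show HomGerm p q from f)

/-- The category `𝛃 C`. -/
instance category : Category.{u} (UltraFamily.{u} C) where
  id_comp f := by
    obtain ⟨s, rfl⟩ := exists_rep f
    exact Germ.mk_congr (hg' := s.ult_map) (b := s.val) fun y => Category.id_comp (s.val y)
  comp_id f := by
    obtain ⟨s, rfl⟩ := exists_rep f
    exact Germ.mk_congr (hg' := s.ult_map) (b := s.val) fun y => Category.comp_id (s.val y)
  assoc f g h := by
    obtain ⟨s, rfl⟩ := exists_rep f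
    obtain ⟨t, rfl⟩ := exists_rep g
    obtain ⟨r, rfl⟩ := exists_rep h
    refine Germ.mk_eq' fun y => ?_
    exact congrArg (Sigma.mk _) (Category.assoc _ _ _)

/-- The morphism with the given representative. -/
def homMk {p q : UltraFamily.{u} C} (g : q.idx → p.idx) (hg : q.ult.map g = p.ult)
    (α : ∀ y, p.fam (g y) ⟶ q.fam y) : p ⟶ q :=
  (Germ.mk ⟨g, hg, α⟩ : HomGerm p q)

theorem exists_homMk {p q : UltraFamily.{u} C} (f : p ⟶ q) :
    ∃ g hg α, f = homMk g hg α := by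
  obtain ⟨⟨g, hg, α⟩, rfl⟩ := exists_rep f
  exact ⟨g, hg, α, rfl⟩

variable (C) in
/-- The unit `η_C : C ⥤ 𝛃 C` of the pseudomonad `𝛃`. -/
def unit : C ⥤ UltraFamily.{u} C where
  obj c := pure c
  map {c d} f := (Germ.pure f : HomGerm (pure c) (pure d))
  map_id _ := rfl
  map_comp _ _ := rfl

/-- The functor `𝛃 f`. -/
def mapFunctor (f : C ⥤ D) : UltraFamily.{u} C ⥤ UltraFamily.{u} D where
  obj p := p.map f.obj
  map {p q} (g : HomGerm p q) := (Germ.map f.obj f.obj (fun _ _ a => f.map a) g :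
    HomGerm (p.map f.obj) (q.map f.obj))
  map_id p := by
    refine Germ.mk_eq' fun y => ?_
    exact congrArg (Sigma.mk _) (f.map_id _)
  map_comp a b := by
    obtain ⟨s, rfl⟩ := exists_rep a
    obtain ⟨t, rfl⟩ := exists_rep b
    refine Germ.mk_eq' fun y => ?_
    exact congrArg (Sigma.mk _) (f.map_comp _ _)

theorem sum_homMk {P Q : UltraFamily.{u} (UltraFamily.{u} C)} (g : Q.idx → P.idx)
    (hg : Q.ult.map g = P.ult) (s : ∀ y, GermRep (homEl C) (P.fam (g y)) (Q.fam y)) :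
    Germ.sum (homMk g hg fun y => (Germ.mk (s y) : HomGerm (P.fam (g y)) (Q.fam y))) =
      Germ.mk (Germ.sumRep g hg s) := Germ.sum_mk g hg s

theorem exists_homMk₂ {P Q : UltraFamily.{u} (UltraFamily.{u} C)} (f : P ⟶ Q) :
    ∃ (g : Q.idx → P.idx) (hg : Q.ult.map g = P.ult)
      (s : ∀ y, GermRep (homEl C) (P.fam (g y)) (Q.fam y)),
      f = homMk g hg fun y => (Germ.mk (s y) : HomGerm (P.fam (g y)) (Q.fam y)) := by
  obtain ⟨g, hg, α, rfl⟩ := exists_homMk f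
  refine ⟨g, hg, fun y => Germ.out (α y : HomGerm _ _), ?_⟩
  congr 1
  funext y
  exact (Germ.mk_out _).symm

variable (C) in
/-- The multiplication `μ_C : 𝛃 (𝛃 C) ⥤ 𝛃 C` of the pseudomonad `𝛃`. -/
noncomputable def mult : UltraFamily.{u} (UltraFamily.{u} C) ⥤ UltraFamily.{u} C where
  obj P := P.sum
  map {P Q} (f : Germ (fun p q => HomGerm p q) P Q) := (Germ.sum f : HomGerm P.sum Q.sum)
  map_id P := sum_homMk id (Ultrafilter.map_id _)
    fun y => ⟨id, Ultrafilter.map_id _, fun z => 𝟙 ((P.fam y).fam z)⟩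
  map_comp {P Q R} f g := by
    obtain ⟨i, hi, s, rfl⟩ := exists_homMk₂ f
    obtain ⟨j, hj, t, rfl⟩ := exists_homMk₂ g
    rw [sum_homMk, sum_homMk]
    exact sum_homMk (fun y => i (j y)) _ fun y =>
      ⟨fun z => (s (j y)).reindex ((t y).reindex z), by
        rw [← (s (j y)).ult_map, ← (t y).ult_map, Ultrafilter.map_map]; rfl,
        fun z => (s (j y)).val ((t y).reindex z) ≫ (t y).val z⟩

/-- The left unit constraint `μ (η p) ⟶ p`, an isomorphism. -/
noncomputable def leftUnit (p : UltraFamily.{u} C) : (mult C).obj ((unit (UltraFamily.{u} C)).obj p) ⟶ p :=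
  homMk (fun y => ⟨PUnit.unit, y⟩) (by
    apply Ultrafilter.coe_injective
    ext S
    rfl) fun y => 𝟙 (p.fam y)

/-- The right unit constraint `μ ((𝛃 η) p) ⟶ p`, an isomorphism. -/
noncomputable def rightUnit (p : UltraFamily.{u} C) : (mult C).obj ((mapFunctor (unit C)).obj p) ⟶ p :=
  homMk (fun y => ⟨y, PUnit.unit⟩) (by
    apply Ultrafilter.coe_injective
    ext S
    rfl) fun y => 𝟙 (p.fam y)

/-- The associativity constraint `μ ((𝛃 μ) Q) ⟶ μ (μ Q)`, an isomorphism. -/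
noncomputable def assoc (Q : UltraFamily.{u} (UltraFamily.{u} (UltraFamily.{u} C))) :
    (mult C).obj ((mapFunctor (mult C)).obj Q) ⟶ (mult C).obj ((mult (UltraFamily.{u} C)).obj Q) :=
  homMk (fun z => ⟨z.1.1, ⟨z.1.2, z.2⟩⟩) (by
    apply Ultrafilter.coe_injective
    ext S
    rfl) fun z => 𝟙 (((Q.fam z.1.1).fam z.1.2).fam z.2)


end UltraFamily

namespace CategoryTheory.Profunctor

section

variable {C : Type v} [Category.{w} C] {D : Type v₁} [Category.{w} D]

/-- The set `F(d, c)` of elements of a profunctor `F` from `C` to `D`, contravariant in `d`. -/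
abbrev El (F : Profunctor.{w₁} C D) (d : D) (c : C) : Type w₁ := (F.obj c).obj (op d)

/-- The contravariant action. -/
def lact (F : Profunctor.{w₁} C D) {d d' : D} {c : C} (f : d' ⟶ d) (x : F.El d c) : F.El d' c :=
  (F.obj c).map f.op x

/-- The covariant action. -/
def ract (F : Profunctor.{w₁} C D) {d : D} {c c' : C} (x : F.El d c) (g : c ⟶ c') : F.El d c' :=
  (F.map g).app (op d) x

variable (F : Profunctor.{w₁} C D)

theorem lact_id {d : D} {c : C} (x : F.El d c) : F.lact (𝟙 d) x = x := by simp [lact]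

theorem lact_comp {d d' d'' : D} {c : C} (f : d'' ⟶ d') (g : d' ⟶ d) (x : F.El d c) :
    F.lact (f ≫ g) x = F.lact f (F.lact g x) := by simp [lact]

theorem ract_id {d : D} {c : C} (x : F.El d c) : F.ract x (𝟙 c) = x := by simp [ract]

theorem ract_comp {d : D} {c c' c'' : C} (x : F.El d c) (f : c ⟶ c') (g : c' ⟶ c'') :
    F.ract x (f ≫ g) = F.ract (F.ract x f) g := by simp [ract]

theorem lact_ract {d d' : D} {c c' : C} (f : d' ⟶ d) (x : F.El d c) (g : c ⟶ c') :
    F.lact f (F.ract x g) = F.ract (F.lact f x) g :=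
  ((F.map g).naturality_apply f.op x).symm

/-- A profunctor from its sets of elements and its two actions. -/
def ofActions (el : D → C → Type w₁)
    (l : ∀ {d d' : D} {c : C}, (d' ⟶ d) → el d c → el d' c)
    (r : ∀ {d : D} {c c' : C}, el d c → (c ⟶ c') → el d c')
    (l_id : ∀ {d c} (x : el d c), l (𝟙 d) x = x)
    (l_comp : ∀ {d d' d'' c} (f : d'' ⟶ d') (g : d' ⟶ d) (x : el d c), l (f ≫ g) x = l f (l g x))
    (r_id : ∀ {d c} (x : el d c), r x (𝟙 c) = x)
    (r_comp : ∀ {d c c' c''} (x : el d c) (f : c ⟶ c') (g : c' ⟶ c''), r x (f ≫ g) = r (r x f) g)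
    (l_r : ∀ {d d' c c'} (f : d' ⟶ d) (x : el d c) (g : c ⟶ c'), l f (r x g) = r (l f x) g) :
    Profunctor.{w₁} C D where
  obj c :=
    { obj d := el d.unop c
      map f := ↾(fun x => l f.unop x)
      map_id d := by ext x; exact l_id x
      map_comp f g := by ext x; exact l_comp g.unop f.unop x }
  map g :=
    { app d := ↾(fun x => r x g)
      naturality d d' f := by ext x; exact (l_r f.unop x g).symm }
  map_id c := by ext d x; exact r_id x
  map_comp f g := by ext d x; exact r_comp x f g

/-- A natural transformation of profunctors, which may be valued in different universes. -/
structure Trans (F : Profunctor.{w₁} C D) (G : Profunctor.{w₂} C D) where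
  app : ∀ {d : D} {c : C}, F.El d c → G.El d c
  app_lact : ∀ {d d' : D} {c : C} (f : d' ⟶ d) (x : F.El d c), app (F.lact f x) = G.lact f (app x)
  app_ract : ∀ {d : D} {c c' : C} (x : F.El d c) (g : c ⟶ c'), app (F.ract x g) = G.ract (app x) g

@[ext]
theorem Trans.ext {F : Profunctor.{w₁} C D} {G : Profunctor.{w₂} C D} {φ ψ : Trans F G}
    (h : ∀ d c (x : F.El d c), φ.app x = ψ.app x) : φ = ψ := by
  obtain ⟨a, _, _⟩ := φ
  obtain ⟨b, _, _⟩ := ψ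
  obtain rfl : @a = @b := by funext d c x; exact h d c x
  rfl

end

section

variable {C : Type v} [Category.{w} C] {D : Type v₁} [Category.{w} D] {E : Type v₂} [Category.{w} E]

/-- The relation `(y · h, x) ~ (y, h · x)`. -/
inductive CoendRel (G : Profunctor.{w₂} D E) (F : Profunctor.{w₁} C D) (e : E) (c : C) :
    (Σ d : D, G.El e d × F.El d c) → (Σ d : D, G.El e d × F.El d c) → Prop
  | mk {d d' : D} (y : G.El e d) (h : d ⟶ d') (x : F.El d' c) :
      CoendRel G F e c ⟨d', G.ract y h, x⟩ ⟨d, y, F.lact h x⟩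

/-- The coend `∫^d G(e, d) × F(d, c)`. -/
def CoendEl (G : Profunctor.{w₂} D E) (F : Profunctor.{w₁} C D) (e : E) (c : C) :
    Type (max v₁ w₁ w₂) := Quot (CoendRel G F e c)

def CoendEl.mk {G : Profunctor.{w₂} D E} {F : Profunctor.{w₁} C D} {e : E} {d : D} {c : C}
    (y : G.El e d) (x : F.El d c) : CoendEl G F e c := Quot.mk _ ⟨d, y, x⟩

theorem CoendEl.mk_ract {G : Profunctor.{w₂} D E} {F : Profunctor.{w₁} C D} {e : E} {d d' : D}
    {c : C} (y : G.El e d) (h : d ⟶ d') (x : F.El d' c) :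
    mk (G.ract y h) x = mk y (F.lact h x) := Quot.sound (.mk y h x)

theorem CoendEl.exists_rep {G : Profunctor.{w₂} D E} {F : Profunctor.{w₁} C D} {e : E} {c : C}
    (z : CoendEl G F e c) : ∃ (d : D) (y : G.El e d) (x : F.El d c), z = mk y x := by
  induction z using Quot.ind with
  | mk z => exact ⟨z.1, z.2.1, z.2.2, rfl⟩

def CoendEl.lift {G : Profunctor.{w₂} D E} {F : Profunctor.{w₁} C D} {e : E} {c : C} {T : Sort*}
    (f : ∀ {d : D}, G.El e d → F.El d c → T)
    (hf : ∀ {d d' : D} (y : G.El e d) (h : d ⟶ d') (x : F.El d' c),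
      f (G.ract y h) x = f y (F.lact h x)) : CoendEl G F e c → T :=
  Quot.lift (fun z => f z.2.1 z.2.2) (by rintro _ _ ⟨y, h, x⟩; exact hf y h x)

/-- The composite profunctor `G ∘ F`. -/
def coendComp (G : Profunctor.{w₂} D E) (F : Profunctor.{w₁} C D) :
    Profunctor.{max v₁ w₁ w₂} C E :=
  ofActions (CoendEl G F)
    (fun f => CoendEl.lift (fun y x => CoendEl.mk (G.lact f y) x)
      (fun y h x => by rw [lact_ract, CoendEl.mk_ract]))
    (fun z g => CoendEl.lift (fun y x => CoendEl.mk y (F.ract x g))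
      (fun y h x => by rw [CoendEl.mk_ract, lact_ract]) z)
    (fun z => by obtain ⟨d, y, x, rfl⟩ := z.exists_rep; exact congrArg (CoendEl.mk · x) (G.lact_id y))
    (fun f g z => by
      obtain ⟨d, y, x, rfl⟩ := z.exists_rep; exact congrArg (CoendEl.mk · x) (G.lact_comp f g y))
    (fun z => by obtain ⟨d, y, x, rfl⟩ := z.exists_rep; exact congrArg (CoendEl.mk y) (F.ract_id x))
    (fun z f g => by
      obtain ⟨d, y, x, rfl⟩ := z.exists_rep; exact congrArg (CoendEl.mk y) (F.ract_comp x f g))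
    (fun f z g => by obtain ⟨d, y, x, rfl⟩ := z.exists_rep; rfl)

/-- The class of `(y, x)` in `G ∘ F`. -/
def pair {G : Profunctor.{w₂} D E} {F : Profunctor.{w₁} C D} {e : E} {d : D} {c : C}
    (y : G.El e d) (x : F.El d c) : (coendComp G F).El e c := CoendEl.mk y x

theorem pair_ract {G : Profunctor.{w₂} D E} {F : Profunctor.{w₁} C D} {e : E} {d d' : D}
    {c : C} (y : G.El e d) (h : d ⟶ d') (x : F.El d' c) :
    pair (G.ract y h) x = pair y (F.lact h x) := Quot.sound (.mk y h x)

theorem exists_pair {G : Profunctor.{w₂} D E} {F : Profunctor.{w₁} C D} {e : E} {c : C}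
    (z : (coendComp G F).El e c) : ∃ (d : D) (y : G.El e d) (x : F.El d c), z = pair y x :=
  CoendEl.exists_rep z

theorem lact_pair {G : Profunctor.{w₂} D E} {F : Profunctor.{w₁} C D} {e e' : E} {d : D} {c : C}
    (f : e' ⟶ e) (y : G.El e d) (x : F.El d c) :
    (coendComp G F).lact f (pair y x) = pair (G.lact f y) x := rfl

theorem ract_pair {G : Profunctor.{w₂} D E} {F : Profunctor.{w₁} C D} {e : E} {d : D} {c c' : C}
    (y : G.El e d) (x : F.El d c) (g : c ⟶ c') :
    (coendComp G F).ract (pair y x) g = pair y (F.ract x g) := rfl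

/-- A natural transformation out of a composite. -/
def Trans.ofPairs {G : Profunctor.{w₂} D E} {F : Profunctor.{w₁} C D} {H : Profunctor.{w₃} C E}
    (f : ∀ {e : E} {d : D} {c : C}, G.El e d → F.El d c → H.El e c)
    (f_bal : ∀ {e d d' c} (y : G.El e d) (h : d ⟶ d') (x : F.El d' c),
      f (G.ract y h) x = f y (F.lact h x))
    (f_l : ∀ {e e' d c} (k : e' ⟶ e) (y : G.El e d) (x : F.El d c),
      f (G.lact k y) x = H.lact k (f y x))
    (f_r : ∀ {e d c c'} (y : G.El e d) (x : F.El d c) (k : c ⟶ c'),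
      f y (F.ract x k) = H.ract (f y x) k) : Trans (coendComp G F) H where
  app := CoendEl.lift f f_bal
  app_lact k z := by obtain ⟨d, y, x, rfl⟩ := exists_pair z; exact f_l k y x
  app_ract z k := by obtain ⟨d, y, x, rfl⟩ := exists_pair z; exact f_r y x k

end

section

variable {C : Type v} [Category.{u} C] {D : Type v₁} [Category.{u} D] {E : Type v₂} [Category.{u} E]

/-- The extension `𝛃̲ F` of a profunctor `F` from `C` to `D` to one from `𝛃 C` to `𝛃 D`. It is
`(𝛃 dom)_⋄ ∘ (𝛃 cod)^⋄` for the span `C ← R → D` of the category `R` of elements of `F`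
(`ultraSpanTrans_bijective` below): an element of `𝛃̲ F (p, q)` is given by a map `g : q.idx → p.idx`
with `g_* (q.ult) = p.ult` and elements of `F (p_{g y}, q_y)`, modulo agreement almost everywhere. -/
def ultra (F : Profunctor.{w} C D) :
    Profunctor.{max u w} (UltraFamily.{u} C) (UltraFamily.{u} D) :=
  ofActions (fun p q => Germ F.El p q)
    (fun {p p' q} (f : UltraFamily.HomGerm p' p) x =>
      Germ.comp (G := homEl D) (F := F.El) (H := F.El) (fun _ _ _ a b => F.lact a b) f x)
    (fun {p q q'} x (g : UltraFamily.HomGerm q q') =>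
      Germ.comp (G := F.El) (F := homEl C) (H := F.El) (fun _ _ _ a b => F.ract a b) x g)
    (fun x => by
      obtain ⟨s, rfl⟩ := Germ.exists_rep x
      exact Germ.mk_congr (hg' := s.ult_map) (b := s.val) fun y => F.lact_id (s.val y))
    (fun f g x => by
      obtain ⟨s, rfl⟩ := Germ.exists_rep x
      obtain ⟨a, rfl⟩ := UltraFamily.exists_rep f
      obtain ⟨b, rfl⟩ := UltraFamily.exists_rep g
      refine Germ.mk_eq' fun y => ?_
      exact congrArg (Sigma.mk _) (F.lact_comp _ _ _))
    (fun x => by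
      obtain ⟨s, rfl⟩ := Germ.exists_rep x
      exact Germ.mk_congr (hg' := s.ult_map) (b := s.val) fun y => F.ract_id (s.val y))
    (fun x f g => by
      obtain ⟨s, rfl⟩ := Germ.exists_rep x
      obtain ⟨a, rfl⟩ := UltraFamily.exists_rep f
      obtain ⟨b, rfl⟩ := UltraFamily.exists_rep g
      refine Germ.mk_eq' fun y => ?_
      exact congrArg (Sigma.mk _) (F.ract_comp _ _ _))
    (fun f x g => by
      obtain ⟨s, rfl⟩ := Germ.exists_rep x
      obtain ⟨a, rfl⟩ := UltraFamily.exists_rep f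
      obtain ⟨b, rfl⟩ := UltraFamily.exists_rep g
      refine Germ.mk_eq' fun y => ?_
      exact congrArg (Sigma.mk _) (F.lact_ract _ _ _))

/-- The naturality of `η` at `F`: the transformation `F(d, c) → 𝛃̲ F (η d, η c)`. -/
def ultraUnit (F : Profunctor.{w} C D) {d : D} {c : C} (x : F.El d c) :
    (ultra F).El ((UltraFamily.unit D).obj d) ((UltraFamily.unit C).obj c) :=
  Germ.pure x

/-- The naturality of `μ` at `F`: the transformation `𝛃̲ (𝛃̲ F) (P, Q) → 𝛃̲ F (μ P, μ Q)`. -/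
noncomputable def ultraMult (F : Profunctor.{w} C D) {P : UltraFamily.{u} (UltraFamily.{u} D)}
    {Q : UltraFamily.{u} (UltraFamily.{u} C)} (x : (ultra (ultra F)).El P Q) :
    (ultra F).El ((UltraFamily.mult D).obj P) ((UltraFamily.mult C).obj Q) :=
  Germ.sum (F := F.El) x

/-- The functoriality of `𝛃̲`: the transformation `𝛃̲ G ∘ 𝛃̲ F → 𝛃̲ (G ∘ F)`. -/
def ultraPair {G : Profunctor.{w₂} D E} {F : Profunctor.{w₁} C D} {o : UltraFamily.{u} E}
    {p : UltraFamily.{u} D} {q : UltraFamily.{u} C} (y : (ultra G).El o p) (x : (ultra F).El p q) :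
    (ultra (coendComp G F)).El o q :=
  Germ.comp (G := G.El) (F := F.El) (H := (coendComp G F).El) (fun _ _ _ a b => pair a b) y x

/-- The element of `𝛃̲ (f_⋄) (𝛃 f p, p)` that corresponds to the identity under
`𝛃̲ (f_⋄) ≅ (𝛃 f)_⋄`. -/
def companionGerm (f : C ⥤ D) (p : UltraFamily.{u} C) :
    (ultra f.toProfunctor).El ((UltraFamily.mapFunctor f).obj p) p :=
  Germ.mk (F := f.toProfunctor.El) (p := (UltraFamily.mapFunctor f).obj p) (q := p)
    ⟨id, Ultrafilter.map_id _, fun y => 𝟙 (f.obj (p.fam y))⟩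

/-- The action of `𝛃̲` on a transformation from `F` to `G ∘ K_⋄ = G(-, K -)`. -/
def Trans.ultra {C' : Type*} [Category.{u} C'] {F : Profunctor.{w₁} C D} {K : C ⥤ C'}
    {G : Profunctor.{w₂} C' D} (φ : Trans F (K ⋙ G)) {p : UltraFamily.{u} D}
    {q : UltraFamily.{u} C} (x : (Profunctor.ultra F).El p q) :
    (Profunctor.ultra G).El p ((UltraFamily.mapFunctor K).obj q) :=
  Germ.map (F := F.El) (G := G.El) id K.obj (fun _ _ r => φ.app r) x

end
end CategoryTheory.Profunctor

namespace CategoryTheory.Profunctor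

section

variable {C : Type v} [Category.{u} C] {D : Type v₁} [Category.{u} D]

/-- The category of elements of a profunctor: objects are `(d, c, x)` with `x ∈ F(d, c)`. -/
structure Elements (F : Profunctor.{w} C D) where
  dom : D
  cod : C
  el : F.El dom cod

namespace Elements

variable {F : Profunctor.{w} C D}

/-- Morphisms `(d, c, x) ⟶ (d', c', x')` are pairs `d ⟶ d'`, `c ⟶ c'` compatible with `x`
and `x'`. -/
@[ext]
structure Hom (x y : Elements F) where
  dom : x.dom ⟶ y.dom
  cod : x.cod ⟶ y.cod
  comm : F.lact dom y.el = F.ract x.el cod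

instance : Category.{u} (Elements F) where
  Hom := Hom
  id x := ⟨𝟙 _, 𝟙 _, (F.lact_id _).trans (F.ract_id _).symm⟩
  comp f g := ⟨f.dom ≫ g.dom, f.cod ≫ g.cod, by
    rw [lact_comp, g.comm, lact_ract, f.comm, ← ract_comp]⟩
  id_comp f := Hom.ext (Category.id_comp f.dom) (Category.id_comp f.cod)
  comp_id f := Hom.ext (Category.comp_id f.dom) (Category.comp_id f.cod)
  assoc f g h := Hom.ext (Category.assoc f.dom g.dom h.dom) (Category.assoc f.cod g.cod h.cod)

variable (F)

/-- The projection to `D`. -/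
def domFunctor : Elements F ⥤ D where
  obj x := x.dom
  map f := f.dom

/-- The projection to `C`. -/
def codFunctor : Elements F ⥤ C where
  obj x := x.cod
  map f := f.cod

variable {F}

/-- The germ of the elements of a family of elements. -/
def germ (Z : UltraFamily.{u} (Elements F)) :
    (ultra F).El ((UltraFamily.mapFunctor (domFunctor F)).obj Z)
      ((UltraFamily.mapFunctor (codFunctor F)).obj Z) :=
  Germ.mk (F := F.El) (p := Z.map dom) (q := Z.map cod)
    ⟨id, Ultrafilter.map_id _, fun z => (Z.fam z).el⟩

theorem lact_germ {Z Z' : UltraFamily.{u} (Elements F)} (m : Z ⟶ Z') :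
    (ultra F).lact ((UltraFamily.mapFunctor (domFunctor F)).map m) (germ Z') =
      (ultra F).ract (germ Z) ((UltraFamily.mapFunctor (codFunctor F)).map m) := by
  obtain ⟨s, rfl⟩ := UltraFamily.exists_rep m
  exact Germ.mk_eq' fun y => congrArg (Sigma.mk _) (s.val y).comm

end Elements

/-- The composite `(𝛃 dom)_⋄ ∘ (𝛃 cod)^⋄` over `𝛃` of the category of elements of `F`. -/
abbrev ultraSpan (F : Profunctor.{w} C D) :
    Profunctor.{max (max (u + 1) v v₁ w) u} (UltraFamily.{u} C) (UltraFamily.{u} D) :=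
  coendComp (UltraFamily.mapFunctor (Elements.domFunctor F)).toProfunctor
    (UltraFamily.mapFunctor (Elements.codFunctor F)).toProfunctorRev

/-- The canonical comparison of the two descriptions of `𝛃̲ F`. -/
def ultraSpanTrans (F : Profunctor.{w} C D) : Trans (ultraSpan F) (ultra F) :=
  Trans.ofPairs
    (fun {p Z q} f g => (ultra F).ract ((ultra F).lact
      (f : p ⟶ (UltraFamily.mapFunctor (Elements.domFunctor F)).obj Z) (Elements.germ Z))
      (g : (UltraFamily.mapFunctor (Elements.codFunctor F)).obj Z ⟶ q))
    (fun f m g => by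
      refine (congrArg ((ultra F).ract · _) (((ultra F).lact_comp f _ _).trans
        ((congrArg ((ultra F).lact f) (Elements.lact_germ m)).trans
          ((ultra F).lact_ract f _ _)))).trans ?_
      exact ((ultra F).ract_comp _ _ g).symm)
    (fun k f g => ((congrArg ((ultra F).ract · _) ((ultra F).lact_comp k f _)).trans
      ((ultra F).lact_ract k _ g).symm))
    (fun f g k => (ultra F).ract_comp _ g k)

section

variable (F : Profunctor.{w} C D)

/-- The class of a pair of morphisms `p ⟶ 𝛃 dom Z` and `𝛃 cod Z ⟶ q`. -/
def spanPair {p : UltraFamily.{u} D} {q : UltraFamily.{u} C} {Z : UltraFamily.{u} (Elements F)}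
    (f : p ⟶ (UltraFamily.mapFunctor (Elements.domFunctor F)).obj Z)
    (g : (UltraFamily.mapFunctor (Elements.codFunctor F)).obj Z ⟶ q) : (ultraSpan F).El p q :=
  pair (G := (UltraFamily.mapFunctor (Elements.domFunctor F)).toProfunctor)
    (F := (UltraFamily.mapFunctor (Elements.codFunctor F)).toProfunctorRev) f g

variable {F}

theorem spanPair_comp {p : UltraFamily.{u} D} {q : UltraFamily.{u} C}
    {Z Z' : UltraFamily.{u} (Elements F)}
    (f : p ⟶ (UltraFamily.mapFunctor (Elements.domFunctor F)).obj Z) (m : Z ⟶ Z')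
    (g : (UltraFamily.mapFunctor (Elements.codFunctor F)).obj Z' ⟶ q) :
    spanPair F (f ≫ (UltraFamily.mapFunctor (Elements.domFunctor F)).map m) g =
      spanPair F f ((UltraFamily.mapFunctor (Elements.codFunctor F)).map m ≫ g) :=
  pair_ract (G := (UltraFamily.mapFunctor (Elements.domFunctor F)).toProfunctor)
    (F := (UltraFamily.mapFunctor (Elements.codFunctor F)).toProfunctorRev) f m g

/-- The class defined by a representative of a germ. -/
def spanOfRep {p : UltraFamily.{u} D} {q : UltraFamily.{u} C} (s : GermRep F.El p q) :
    (ultraSpan F).El p q :=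
  spanPair F (Z := ⟨q.idx, fun y => ⟨p.fam (s.reindex y), q.fam y, s.val y⟩, q.ult⟩)
    (UltraFamily.homMk s.reindex s.ult_map fun y => 𝟙 (p.fam (s.reindex y)))
    (UltraFamily.homMk id (Ultrafilter.map_id _) fun y => 𝟙 (q.fam y))

theorem ultraSpanTrans_spanOfRep {p : UltraFamily.{u} D} {q : UltraFamily.{u} C}
    (s : GermRep F.El p q) : (ultraSpanTrans F).app (spanOfRep s) = Germ.mk s :=
  Germ.mk_eq' fun _ => congrArg (Sigma.mk _) ((F.ract_id _).trans (F.lact_id _))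

theorem spanPair_eq_spanOfRep {p : UltraFamily.{u} D} {q : UltraFamily.{u} C}
    {Z : UltraFamily.{u} (Elements F)} (i : Z.idx → p.idx) (hi : Z.ult.map i = p.ult)
    (α : ∀ z, p.fam (i z) ⟶ (Z.fam z).dom) (j : q.idx → Z.idx) (hj : q.ult.map j = Z.ult)
    (β : ∀ y, (Z.fam (j y)).cod ⟶ q.fam y) :
    ∃ s, spanPair F (p := p) (q := q) (Z := Z) (UltraFamily.homMk i hi α)
      (UltraFamily.homMk j hj β) = spanOfRep s := by
  let Z' : UltraFamily.{u} (Elements F) :=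
    ⟨q.idx, fun y => ⟨(Z.fam (j y)).dom, q.fam y, F.ract (Z.fam (j y)).el (β y)⟩, q.ult⟩
  let s : GermRep F.El p q := ⟨fun y => i (j y), by
    rw [← hi, ← hj, Ultrafilter.map_map]; rfl,
    fun y => F.lact (α (j y)) (F.ract (Z.fam (j y)).el (β y))⟩
  let m : Z ⟶ Z' := UltraFamily.homMk j hj fun y =>
    (⟨𝟙 _, β y, F.lact_id _⟩ : Elements.Hom (Z.fam (j y)) (Z'.fam y))
  let Z'' : UltraFamily.{u} (Elements F) :=
    ⟨q.idx, fun y => ⟨p.fam (s.reindex y), q.fam y, s.val y⟩, q.ult⟩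
  let n : Z'' ⟶ Z' := UltraFamily.homMk id (Ultrafilter.map_id _) fun y =>
    (⟨α (j y), 𝟙 _, (F.ract_id _).symm⟩ : Elements.Hom (Z''.fam y) (Z'.fam y))
  let g : (UltraFamily.mapFunctor (Elements.codFunctor F)).obj Z' ⟶ q :=
    UltraFamily.homMk id (Ultrafilter.map_id _) fun y => 𝟙 (q.fam y)
  let f : p ⟶ (UltraFamily.mapFunctor (Elements.domFunctor F)).obj Z'' :=
    UltraFamily.homMk s.reindex s.ult_map fun y => 𝟙 (p.fam (s.reindex y))
  have h₁ : (UltraFamily.mapFunctor (Elements.codFunctor F)).map m ≫ g =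
      UltraFamily.homMk j hj β :=
    Germ.mk_eq' fun y => congrArg (Sigma.mk _) (Category.comp_id (β y))
  have h₂ : UltraFamily.homMk i hi α ≫ (UltraFamily.mapFunctor (Elements.domFunctor F)).map m =
      f ≫ (UltraFamily.mapFunctor (Elements.domFunctor F)).map n :=
    Germ.mk_eq' fun y => congrArg (Sigma.mk _)
      ((Category.comp_id (α (j y))).trans (Category.id_comp (α (j y))).symm)
  have h₃ : (UltraFamily.mapFunctor (Elements.codFunctor F)).map n ≫ g =
      UltraFamily.homMk id (Ultrafilter.map_id _) fun y => 𝟙 (q.fam y) :=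
    Germ.mk_eq' fun y => congrArg (Sigma.mk _) (Category.comp_id (𝟙 (q.fam y)))
  refine ⟨s, ?_⟩
  calc _ = spanPair F (UltraFamily.homMk i hi α)
        ((UltraFamily.mapFunctor (Elements.codFunctor F)).map m ≫ g) := by rw [h₁]
    _ = spanPair F (f ≫ (UltraFamily.mapFunctor (Elements.domFunctor F)).map n) g := by
      rw [← spanPair_comp, h₂]
    _ = _ := by rw [spanPair_comp, h₃]; rfl

theorem spanOfRep_eq {F : Profunctor.{u} C D} {p : UltraFamily.{u} D} {q : UltraFamily.{u} C}
    {s t : GermRep F.El p q} (h : ∀ᶠ y in (q.ult : Filter q.idx), s.pt y = t.pt y) :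
    spanOfRep s = spanOfRep t := by
  let W : UltraFamily.{u} (Elements F) :=
    ⟨Σ y : q.idx, Σ x : p.idx, F.El (p.fam x) (q.fam y),
      fun a => ⟨p.fam a.2.1, q.fam a.1, a.2.2⟩, q.ult.map fun y => ⟨y, s.pt y⟩⟩
  have hW : q.ult.map (fun y => (⟨y, t.pt y⟩ : W.idx)) = W.ult :=
    Ultrafilter.coe_injective <| Filter.map_congr <| by
      filter_upwards [h] with y hy
      rw [hy]
  let f : p ⟶ (UltraFamily.mapFunctor (Elements.domFunctor F)).obj W :=
    UltraFamily.homMk (fun a => a.2.1)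
      ((Ultrafilter.map_map _ _ _).trans s.ult_map) fun a => 𝟙 (p.fam a.2.1)
  have aux (r : GermRep F.El p q) (hr : q.ult.map (fun y => (⟨y, r.pt y⟩ : W.idx)) = W.ult) :
      spanOfRep r = spanPair F f (UltraFamily.homMk (fun y => ⟨y, r.pt y⟩) hr
        fun y => 𝟙 (q.fam y)) := by
    let m : W ⟶ ⟨q.idx, fun y => ⟨p.fam (r.reindex y), q.fam y, r.val y⟩, q.ult⟩ :=
      UltraFamily.homMk (fun y => ⟨y, r.pt y⟩) hr
        fun y => 𝟙 (⟨p.fam (r.reindex y), q.fam y, r.val y⟩ : Elements F)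
    refine Eq.trans ?_ ((spanPair_comp f m (UltraFamily.homMk (q := q) id
      (Ultrafilter.map_id _) fun y => 𝟙 (q.fam y))).trans ?_)
    · refine congrArg (spanPair F · _) ?_
      exact Germ.mk_eq' fun y => congrArg (Sigma.mk _) (Category.comp_id (𝟙 (p.fam _))).symm
    · refine congrArg (spanPair F f) ?_
      exact Germ.mk_eq' fun y => congrArg (Sigma.mk _) (Category.comp_id (𝟙 (q.fam _)))
  rw [aux s rfl, aux t hW]
  refine congrArg (spanPair F f) (Germ.mk_eq ?_)
  filter_upwards [h] with y hy
  exact congrArg (fun a => (⟨⟨y, a⟩, 𝟙 (q.fam y)⟩ : Σ x : W.idx, ((W.fam x).cod ⟶ q.fam y))) hy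

/-- `𝛃̲ F`, as defined by germs, is the composite `(𝛃 dom)_⋄ ∘ (𝛃 cod)^⋄`. -/
theorem ultraSpanTrans_bijective (F : Profunctor.{u} C D) (p : UltraFamily.{u} D)
    (q : UltraFamily.{u} C) :
    Function.Bijective (fun x : (ultraSpan F).El p q => (ultraSpanTrans F).app x) := by
  refine ⟨fun x x' h => ?_, fun y => ?_⟩
  · have aux : ∀ x : (ultraSpan F).El p q, ∃ s, x = spanOfRep s := fun x => by
      obtain ⟨Z, f, g, rfl⟩ := exists_pair x
      obtain ⟨i, hi, α, rfl⟩ := UltraFamily.exists_homMk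
        (show p ⟶ (UltraFamily.mapFunctor (Elements.domFunctor F)).obj Z from f)
      obtain ⟨j, hj, β, rfl⟩ := UltraFamily.exists_homMk
        (show (UltraFamily.mapFunctor (Elements.codFunctor F)).obj Z ⟶ q from g)
      exact spanPair_eq_spanOfRep i hi α j hj β
    obtain ⟨s, rfl⟩ := aux x
    obtain ⟨t, rfl⟩ := aux x'
    refine spanOfRep_eq (Germ.mk_eq_iff.1 ?_)
    rw [← ultraSpanTrans_spanOfRep, ← ultraSpanTrans_spanOfRep]
    exact h
  · obtain ⟨s, rfl⟩ := Germ.exists_rep y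
    exact ⟨spanOfRep s, ultraSpanTrans_spanOfRep s⟩

end

end

end CategoryTheory.Profunctor

open CategoryTheory.Profunctor

/-- A lax algebra structure on the category `C` for the extension `𝛃̲` of `𝛃` to profunctors: a
profunctor `A` from `𝛃 C` to `C`, a unitor `Γ : 1 ⇒ A ∘ η_⋄` and a multiplicator
`Δ : A ∘ 𝛃̲ A ⇒ A ∘ μ_⋄`, with the unit and associativity axioms. Here `A ∘ K_⋄` is `K ⋙ A`. -/
structure LaxAlgebra (C : Type (u + 1)) [Category.{u} C] where
  prof : Profunctor.{u} (UltraFamily.{u} C) C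
  unit : Trans (Profunctor.id (C := C)) (UltraFamily.unit C ⋙ prof)
  mult : Trans (coendComp prof (ultra prof)) (UltraFamily.mult C ⋙ prof)
  unit_left : ∀ {a : C} {p : UltraFamily.{u} C} (r : prof.El a p),
    prof.ract (c := (UltraFamily.mult C).obj ((UltraFamily.unit _).obj p))
      (mult.app (pair (unit.app (𝟙 a)) (ultraUnit prof r))) (UltraFamily.leftUnit p) = r
  unit_right : ∀ {a : C} {p : UltraFamily.{u} C} (r : prof.El a p),
    prof.ract (c := (UltraFamily.mult C).obj ((UltraFamily.mapFunctor (UltraFamily.unit C)).obj p))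
      (mult.app (pair r (unit.ultra (𝟙 p)))) (UltraFamily.rightUnit p) = r
  assoc : ∀ {a : C} {W : UltraFamily.{u} C} {P : UltraFamily.{u} (UltraFamily.{u} C)}
    {Q : UltraFamily.{u} (UltraFamily.{u} (UltraFamily.{u} C))}
    (r : prof.El a W) (s : (ultra prof).El W P) (t : (ultra (ultra prof)).El P Q),
    prof.ract (c := (UltraFamily.mult C).obj ((UltraFamily.mapFunctor (UltraFamily.mult C)).obj Q))
      (mult.app (pair r (mult.ultra (ultraPair s t)))) (UltraFamily.assoc Q) =
    mult.app (pair (F := ultra prof) (G := prof)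
      (d := (UltraFamily.mult C).obj P) (c := (UltraFamily.mult (UltraFamily.{u} C)).obj Q)
      (mult.app (pair r s)) (ultraMult prof t))

/-- A (possibly large) locally small category with a lax algebra structure. -/
structure LaxAlg where
  carrier : Type (u + 1)
  [cat : Category.{u} carrier]
  str : LaxAlgebra carrier

namespace LaxAlg

attribute [instance] LaxAlg.cat

abbrev prof (A : LaxAlg.{u}) : Profunctor.{u} (UltraFamily.{u} A.carrier) A.carrier := A.str.prof

/-- The component of the unitor. -/
def unitEl (A : LaxAlg.{u}) {a a' : A.carrier} (f : a ⟶ a') :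
    A.prof.El a ((UltraFamily.unit A.carrier).obj a') :=
  A.str.unit.app f

/-- The component of the multiplicator. -/
def multEl (A : LaxAlg.{u}) {a : A.carrier} {W : UltraFamily.{u} A.carrier}
    {P : UltraFamily.{u} (UltraFamily.{u} A.carrier)} (r : A.prof.El a W)
    (s : (ultra A.prof).El W P) : A.prof.El a ((UltraFamily.mult A.carrier).obj P) :=
  A.str.mult.app (pair r s)

section

variable (A : LaxAlg.{u})

theorem lact_unitEl {a a' a'' : A.carrier} (f : a ⟶ a') (g : a' ⟶ a'') :
    A.prof.lact f (A.unitEl g) = A.unitEl (f ≫ g) := (A.str.unit.app_lact f g).symm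

theorem ract_unitEl {a a' a'' : A.carrier} (f : a ⟶ a') (g : a' ⟶ a'') :
    A.prof.ract (A.unitEl f) ((UltraFamily.unit A.carrier).map g) = A.unitEl (f ≫ g) :=
  (A.str.unit.app_ract f g).symm

theorem lact_multEl {a a' : A.carrier} {W : UltraFamily.{u} A.carrier}
    {P : UltraFamily.{u} (UltraFamily.{u} A.carrier)} (f : a' ⟶ a) (r : A.prof.El a W)
    (s : (ultra A.prof).El W P) :
    A.prof.lact f (A.multEl r s) = A.multEl (A.prof.lact f r) s :=
  (A.str.mult.app_lact f (pair r s)).symm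

theorem ract_multEl {a : A.carrier} {W : UltraFamily.{u} A.carrier}
    {P Q : UltraFamily.{u} (UltraFamily.{u} A.carrier)} (r : A.prof.El a W)
    (s : (ultra A.prof).El W P) (g : P ⟶ Q) :
    A.prof.ract (A.multEl r s) ((UltraFamily.mult A.carrier).map g) =
      A.multEl r ((ultra A.prof).ract s g) :=
  (A.str.mult.app_ract (pair r s) g).symm

theorem multEl_ract {a : A.carrier} {V W : UltraFamily.{u} A.carrier}
    {P : UltraFamily.{u} (UltraFamily.{u} A.carrier)} (r : A.prof.El a V) (g : V ⟶ W)
    (s : (ultra A.prof).El W P) :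
    A.multEl (A.prof.ract r g) s = A.multEl r ((ultra A.prof).lact g s) :=
  congrArg A.str.mult.app (pair_ract r g s)

end

/-- A representable colax morphism: a functor `f` and a transformation
`Θ : f_⋄ ∘ A ⇒ B ∘ 𝛃̲ (f_⋄) = B ∘ (𝛃 f)_⋄` compatible with unitors and multiplicators. -/
structure ColaxHom (A B : LaxAlg.{u}) where
  functor : A.carrier ⥤ B.carrier
  cell : Trans (coendComp functor.toProfunctor A.prof) (UltraFamily.mapFunctor functor ⋙ B.prof)
  cell_unit : ∀ {b : B.carrier} {a : A.carrier} (k : functor.toProfunctor.El b a),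
    cell.app (pair k (A.unitEl (𝟙 a))) = B.unitEl (k : b ⟶ functor.obj a)
  cell_mult : ∀ {b : B.carrier} {a : A.carrier} {W : UltraFamily.{u} A.carrier}
    {P : UltraFamily.{u} (UltraFamily.{u} A.carrier)} (k : functor.toProfunctor.El b a)
    (r : A.prof.El a W) (s : (ultra A.prof).El W P),
    cell.app (pair k (A.multEl r s)) =
      B.multEl (W := (UltraFamily.mapFunctor functor).obj W)
        (P := (UltraFamily.mapFunctor (UltraFamily.mapFunctor functor)).obj P)
        (cell.app (pair k r)) (cell.ultra (ultraPair (companionGerm functor W) s))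

namespace ColaxHom

/-- The action of a representable colax morphism on the elements of `A(a, p)`. -/
def onArrows {A B : LaxAlg.{u}} (φ : ColaxHom A B) {a : A.carrier}
    {p : UltraFamily.{u} A.carrier} (r : A.prof.El a p) :
    B.prof.El (φ.functor.obj a) ((UltraFamily.mapFunctor φ.functor).obj p) :=
  φ.cell.app (pair (G := φ.functor.toProfunctor) (𝟙 (φ.functor.obj a)) r)

theorem ext_cell {A B : LaxAlg.{u}} {f : A.carrier ⥤ B.carrier}
    {Θ Θ' : Trans (coendComp f.toProfunctor A.prof) (UltraFamily.mapFunctor f ⋙ B.prof)}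
    {h₁ h₁' h₂ h₂'}
    (h : ∀ {b a p} (k : f.toProfunctor.El b a) (r : A.prof.El a p),
      Θ.app (pair k r) = Θ'.app (pair k r)) :
    (⟨f, Θ, h₁, h₂⟩ : ColaxHom A B) = ⟨f, Θ', h₁', h₂'⟩ := by
  obtain rfl : Θ = Θ' := by
    ext d c x
    obtain ⟨a, k, r, rfl⟩ := exists_pair x
    exact h k r
  rfl

variable {A B : LaxAlg.{u}} (φ : ColaxHom A B)

theorem cell_pair {b : B.carrier} {a : A.carrier} {p : UltraFamily.{u} A.carrier}
    (k : b ⟶ φ.functor.obj a) (r : A.prof.El a p) :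
    φ.cell.app (pair (G := φ.functor.toProfunctor) k r) = B.prof.lact k (φ.onArrows r) := by
  refine Eq.trans ?_ (φ.cell.app_lact k _)
  exact congrArg (fun h => φ.cell.app (pair (G := φ.functor.toProfunctor) h r))
    (Category.comp_id k).symm

theorem onArrows_lact {a a' : A.carrier} {p : UltraFamily.{u} A.carrier}
    (f : a' ⟶ a) (r : A.prof.El a p) :
    φ.onArrows (A.prof.lact f r) = B.prof.lact (φ.functor.map f) (φ.onArrows r) := by
  rw [← cell_pair]
  refine (congrArg φ.cell.app (pair_ract (G := φ.functor.toProfunctor) (F := A.prof)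
    (𝟙 (φ.functor.obj a')) f r)).symm.trans ?_
  exact congrArg (fun h => φ.cell.app (pair (G := φ.functor.toProfunctor) h r))
    (Category.id_comp (φ.functor.map f))

theorem onArrows_ract {a : A.carrier} {p q : UltraFamily.{u} A.carrier}
    (r : A.prof.El a p) (g : p ⟶ q) :
    φ.onArrows (A.prof.ract r g) =
      B.prof.ract (φ.onArrows r) ((UltraFamily.mapFunctor φ.functor).map g) :=
  φ.cell.app_ract (pair (G := φ.functor.toProfunctor) _ r) g

theorem onArrows_unit (a : A.carrier) :
    φ.onArrows (A.unitEl (𝟙 a)) = B.unitEl (𝟙 (φ.functor.obj a)) := φ.cell_unit _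

/-- The action of a representable colax morphism on germs of elements. -/
def onGerms {p : UltraFamily.{u} A.carrier} {q : UltraFamily.{u} (UltraFamily.{u} A.carrier)}
    (s : (ultra A.prof).El p q) :
    (ultra B.prof).El ((UltraFamily.mapFunctor φ.functor).obj p)
      ((UltraFamily.mapFunctor (UltraFamily.mapFunctor φ.functor)).obj q) :=
  Germ.map (F := A.prof.El) (G := B.prof.El) φ.functor.obj
    (UltraFamily.mapFunctor φ.functor).obj (fun _ _ r => φ.onArrows r) s

theorem cell_ultra {p : UltraFamily.{u} A.carrier}
    {q : UltraFamily.{u} (UltraFamily.{u} A.carrier)} (s : (ultra A.prof).El p q) :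
    φ.cell.ultra (ultraPair (companionGerm φ.functor p) s) = φ.onGerms s := by
  obtain ⟨s, rfl⟩ := Germ.exists_rep s
  rfl

theorem onArrows_mult {a : A.carrier} {W : UltraFamily.{u} A.carrier}
    {P : UltraFamily.{u} (UltraFamily.{u} A.carrier)} (r : A.prof.El a W)
    (s : (ultra A.prof).El W P) :
    φ.onArrows (A.multEl r s) = B.multEl
      (P := (UltraFamily.mapFunctor (UltraFamily.mapFunctor φ.functor)).obj P)
      (φ.onArrows r) (φ.onGerms s) := by
  rw [← cell_ultra]
  exact φ.cell_mult _ r s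

/-- A representable colax morphism from its action on elements. -/
def ofOnArrows (f : A.carrier ⥤ B.carrier)
    (m : ∀ {a : A.carrier} {p : UltraFamily.{u} A.carrier}, A.prof.El a p →
      B.prof.El (f.obj a) ((UltraFamily.mapFunctor f).obj p))
    (m_lact : ∀ {a a' p} (k : a' ⟶ a) (r : A.prof.El a p),
      m (A.prof.lact k r) = B.prof.lact (f.map k) (m r))
    (m_ract : ∀ {a p q} (r : A.prof.El a p) (g : p ⟶ q),
      m (A.prof.ract r g) = B.prof.ract (m r) ((UltraFamily.mapFunctor f).map g))
    (m_unit : ∀ a, m (A.unitEl (𝟙 a)) = B.unitEl (𝟙 (f.obj a)))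
    (m_mult : ∀ {a W P} (r : A.prof.El a W) (s : (ultra A.prof).El W P),
      m (A.multEl r s) = B.multEl
        (P := (UltraFamily.mapFunctor (UltraFamily.mapFunctor f)).obj P) (m r)
        (Germ.map (F := A.prof.El) (G := B.prof.El) f.obj
          (UltraFamily.mapFunctor f).obj (fun _ _ r => m r) s)) : ColaxHom A B where
  functor := f
  cell := Trans.ofPairs (fun k r => B.prof.lact (k : _ ⟶ _) (m r))
    (fun y h x => by
      rw [m_lact]; exact B.prof.lact_comp y (f.map h) (m x))
    (fun k y x => B.prof.lact_comp k y (m x))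
    (fun y x k => by rw [m_ract]; exact B.prof.lact_ract _ _ _)
  cell_unit k := by
    refine (congrArg (B.prof.lact _) (m_unit _)).trans ?_
    refine (B.lact_unitEl _ _).trans ?_
    exact congrArg B.unitEl (Category.comp_id _)
  cell_mult k r s := by
    obtain ⟨s, rfl⟩ := Germ.exists_rep s
    refine (congrArg (B.prof.lact _) (m_mult r _)).trans ?_
    refine (B.lact_multEl _ _ _).trans ?_
    refine congrArg (B.multEl _) ?_
    refine Germ.mk_congr fun y => ?_
    exact (B.prof.lact_id _).symm

end ColaxHom
end LaxAlg

namespace LaxAlg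

theorem ColaxHom.ext_onArrows {A B : LaxAlg.{u}} {φ ψ : ColaxHom A B} (hf : φ.functor = ψ.functor)
    (h : ∀ (a : A.carrier) (p : UltraFamily.{u} A.carrier) (r : A.prof.El a p),
      HEq (φ.onArrows r) (ψ.onArrows r)) : φ = ψ := by
  obtain ⟨f, Θ, h₁, h₂⟩ := φ
  obtain ⟨f', Θ', h₁', h₂'⟩ := ψ
  obtain rfl : f = f' := hf
  refine ColaxHom.ext_cell fun k r => ?_
  refine (ColaxHom.cell_pair ⟨f, Θ, h₁, h₂⟩ k r).trans ?_
  refine Eq.trans ?_ (ColaxHom.cell_pair ⟨f, Θ', h₁', h₂'⟩ k r).symm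
  exact congrArg (B.prof.lact k) (eq_of_heq (h _ _ r))

theorem ColaxHom.onArrows_ofOnArrows {A B : LaxAlg.{u}} (f : A.carrier ⥤ B.carrier)
    (m : ∀ {a : A.carrier} {p : UltraFamily.{u} A.carrier}, A.prof.El a p →
      B.prof.El (f.obj a) ((UltraFamily.mapFunctor f).obj p)) (h₁ h₂ h₃ h₄)
    {a : A.carrier} {p : UltraFamily.{u} A.carrier} (r : A.prof.El a p) :
    (ofOnArrows f m h₁ h₂ h₃ h₄).onArrows r = m r :=
  B.prof.lact_id _

/-- The identity, `Θ [u, r] = u · r`. -/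
def idHom (A : LaxAlg.{u}) : ColaxHom A A :=
  ColaxHom.ofOnArrows (𝟭 _) (fun r => r) (fun _ _ => rfl)
    (fun r g => by obtain ⟨s, rfl⟩ := UltraFamily.exists_rep g; rfl)
    (fun _ => rfl)
    (fun r s => by obtain ⟨s, rfl⟩ := Germ.exists_rep s; rfl)

/-- The composite, with the pasting of the two transformations. -/
def compHom {A B C : LaxAlg.{u}} (φ : ColaxHom A B) (ψ : ColaxHom B C) : ColaxHom A C :=
  ColaxHom.ofOnArrows (φ.functor ⋙ ψ.functor) (fun r => ψ.onArrows (φ.onArrows r))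
    (fun k r => by rw [φ.onArrows_lact, ψ.onArrows_lact]; rfl)
    (fun r g => by
      obtain ⟨s, rfl⟩ := UltraFamily.exists_rep g
      rw [φ.onArrows_ract]
      exact ψ.onArrows_ract _ _)
    (fun a => (congrArg ψ.onArrows (φ.onArrows_unit a)).trans (ψ.onArrows_unit _))
    (fun r s => by
      obtain ⟨s, rfl⟩ := Germ.exists_rep s
      exact (congrArg ψ.onArrows (φ.onArrows_mult _ _)).trans (ψ.onArrows_mult _ _))

/-- The category of lax algebras and representable colax morphisms. -/
instance category : Category LaxAlg.{u} where
  Hom := ColaxHom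
  id := idHom
  comp := compHom
  id_comp φ := ColaxHom.ext_onArrows rfl fun _ _ r => heq_of_eq <| by
    refine (ColaxHom.onArrows_ofOnArrows _ _ _ _ _ _ r).trans ?_
    exact congrArg φ.onArrows (ColaxHom.onArrows_ofOnArrows _ _ _ _ _ _ r)
  comp_id φ := ColaxHom.ext_onArrows rfl fun _ _ r => heq_of_eq <| by
    refine (ColaxHom.onArrows_ofOnArrows _ _ _ _ _ _ r).trans ?_
    exact (ColaxHom.onArrows_ofOnArrows _ _ _ _ _ _ (φ.onArrows r))
  assoc φ ψ χ := ColaxHom.ext_onArrows rfl fun _ _ r => heq_of_eq <| by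
    refine (ColaxHom.onArrows_ofOnArrows _ _ _ _ _ _ r).trans ?_
    refine (congrArg χ.onArrows (ColaxHom.onArrows_ofOnArrows _ _ _ _ _ _ r)).trans ?_
    refine Eq.symm ((ColaxHom.onArrows_ofOnArrows _ _ _ _ _ _ r).trans ?_)
    exact ColaxHom.onArrows_ofOnArrows _ _ _ _ _ _ (φ.onArrows r)

end LaxAlg

theorem UltraFamily.assoc_leftUnit {C : Type v} [Category.{u} C] (p : UltraFamily.{u} C) :
    UltraFamily.assoc ((UltraFamily.unit _).obj ((UltraFamily.unit _).obj p)) ≫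
      (UltraFamily.mult C).map (UltraFamily.leftUnit ((UltraFamily.unit _).obj p)) ≫
        UltraFamily.leftUnit p =
    (UltraFamily.mult C).map ((UltraFamily.unit _).map (UltraFamily.leftUnit p)) ≫
        UltraFamily.leftUnit p := by
  have h₁ : (UltraFamily.mult C).map (UltraFamily.leftUnit ((UltraFamily.unit _).obj p)) = _ :=
    UltraFamily.sum_homMk
      (P := (UltraFamily.mult _).obj ((UltraFamily.unit _).obj ((UltraFamily.unit _).obj p)))
      (Q := (UltraFamily.unit _).obj p) (fun y => ⟨PUnit.unit, y⟩) (by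
        apply Ultrafilter.coe_injective
        ext S
        rfl) fun _ => ⟨id, Ultrafilter.map_id _, fun z => 𝟙 (p.fam z)⟩
  have h₂ : (UltraFamily.mult C).map ((UltraFamily.unit _).map (UltraFamily.leftUnit p)) = _ :=
    UltraFamily.sum_homMk
      (P := (UltraFamily.unit _).obj ((UltraFamily.mult _).obj ((UltraFamily.unit _).obj p)))
      (Q := (UltraFamily.unit _).obj p) (fun _ => PUnit.unit) (Ultrafilter.map_pure _ _)
      fun _ => ⟨fun y => ⟨PUnit.unit, y⟩, by
        apply Ultrafilter.coe_injective
        ext S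
        rfl, fun z => 𝟙 (p.fam z)⟩
  rw [h₁, h₂]
  refine Germ.mk_eq' fun y => ?_
  exact congrArg (Sigma.mk _) (Category.id_comp (𝟙 (p.fam y) ≫ 𝟙 (p.fam y)))

namespace LaxAlg

variable (A : LaxAlg.{u})

/-- The action of an element `t` of `A(a, η a')` on an element `r` of `A(a', p)`: the composite
`(r)_{* : 1} · t`, an element of `A(a, p)`. -/
noncomputable def ptAct {a a' : A.carrier} {p : UltraFamily.{u} A.carrier}
    (t : A.prof.El a ((UltraFamily.unit A.carrier).obj a')) (r : A.prof.El a' p) :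
    A.prof.El a p :=
  A.prof.ract (c := (UltraFamily.mult A.carrier).obj ((UltraFamily.unit _).obj p))
    (A.multEl t (ultraUnit A.prof r)) (UltraFamily.leftUnit p)

theorem ptAct_unitEl {a : A.carrier} {p : UltraFamily.{u} A.carrier} (r : A.prof.El a p) :
    A.ptAct (A.unitEl (𝟙 a)) r = r := A.str.unit_left r

theorem ptAct_unit {a a' : A.carrier} (t : A.prof.El a ((UltraFamily.unit A.carrier).obj a')) :
    A.ptAct t (A.unitEl (𝟙 a')) = t :=
  A.str.unit_right t

theorem ptAct_assoc {a a' a'' : A.carrier} {p : UltraFamily.{u} A.carrier}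
    (t : A.prof.El a ((UltraFamily.unit A.carrier).obj a'))
    (t' : A.prof.El a' ((UltraFamily.unit A.carrier).obj a'')) (r : A.prof.El a'' p) :
    A.ptAct (A.ptAct t t') r = A.ptAct t (A.ptAct t' r) := by
  have h := A.str.assoc t (ultraUnit A.prof t')
    (ultraUnit (ultra A.prof) (ultraUnit A.prof r))
  have h₁ : (ultra A.prof).lact (UltraFamily.leftUnit _) (ultraUnit A.prof r) =
      (ultra A.prof).ract
        (c := (UltraFamily.mult _).obj ((UltraFamily.unit _).obj ((UltraFamily.unit _).obj p)))
        (ultraMult A.prof (ultraUnit (ultra A.prof) (ultraUnit A.prof r)))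
        (UltraFamily.leftUnit ((UltraFamily.unit _).obj p)) := by
    have e : ultraMult A.prof (ultraUnit (ultra A.prof) (ultraUnit A.prof r)) = _ :=
      Germ.sum_mk (F := A.prof.El)
        (P := (UltraFamily.unit _).obj ((UltraFamily.unit _).obj a''))
        (Q := (UltraFamily.unit _).obj ((UltraFamily.unit _).obj p)) (fun _ => PUnit.unit)
        (Ultrafilter.map_pure _ _) fun _ => ⟨fun _ => PUnit.unit, Ultrafilter.map_pure _ _, fun _ => r⟩
    refine Eq.trans ?_ (congrArg (fun z => (ultra A.prof).ract
        (c := (UltraFamily.mult _).obj ((UltraFamily.unit _).obj ((UltraFamily.unit _).obj p)))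
        z (UltraFamily.leftUnit ((UltraFamily.unit _).obj p))) e.symm)
    refine Germ.mk_eq' fun y => ?_
    exact congrArg (Sigma.mk _) ((A.prof.lact_id r).trans (A.prof.ract_id r).symm)
  have h₂ : ultraUnit A.prof (A.ptAct t' r) =
      (ultra A.prof).ract (ultraUnit A.prof (A.multEl t' (ultraUnit A.prof r)))
        ((UltraFamily.unit _).map (UltraFamily.leftUnit p)) := rfl
  have hL : A.ptAct (A.ptAct t t') r = A.prof.ract (A.prof.ract
      (A.multEl (A.multEl t (ultraUnit A.prof t'))
        (ultraMult A.prof (ultraUnit (ultra A.prof) (ultraUnit A.prof r))))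
      ((UltraFamily.mult _).map (UltraFamily.leftUnit ((UltraFamily.unit _).obj p))))
      (UltraFamily.leftUnit p) := by
    refine congrArg (A.prof.ract · (UltraFamily.leftUnit p)) ?_
    refine (A.multEl_ract _ _ _).trans ((congrArg (A.multEl _) h₁).trans ?_)
    exact (A.ract_multEl _ _ _).symm
  have hR : A.ptAct t (A.ptAct t' r) = A.prof.ract (A.prof.ract
      (A.multEl t (ultraUnit A.prof (A.multEl t' (ultraUnit A.prof r))))
      ((UltraFamily.mult _).map ((UltraFamily.unit _).map (UltraFamily.leftUnit p))))
      (UltraFamily.leftUnit p) := by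
    refine congrArg (A.prof.ract · (UltraFamily.leftUnit p)) ?_
    rw [h₂]
    exact (A.ract_multEl _ _ _).symm
  rw [hL, hR, ← ract_comp, ← ract_comp]
  refine Eq.trans ?_ (congrArg (A.prof.ract _) (UltraFamily.assoc_leftUnit p))
  refine Eq.trans ?_ (ract_comp _ _ (UltraFamily.assoc _) _).symm
  exact congrArg (A.prof.ract · _) h.symm


/-- The objects of the category of points of `A`. -/
def Pt : Type (u + 1) := A.carrier

/-- The category of points of `A`: the morphisms from `a` to `a'` are the elements of `A(a, η a')`. -/
noncomputable instance : Category.{u} A.Pt where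
  Hom a a' := A.prof.El (d := a) (c := (UltraFamily.unit A.carrier).obj a')
  id a := A.unitEl (CategoryStruct.id (obj := A.carrier) a)
  comp t t' := A.ptAct t t'
  id_comp t := A.ptAct_unitEl t
  comp_id t := A.ptAct_unit t
  assoc t t' r := A.ptAct_assoc t t' r

theorem lact_ptAct {b a a' : A.carrier} {p : UltraFamily.{u} A.carrier} (f : b ⟶ a)
    (t : A.prof.El a ((UltraFamily.unit A.carrier).obj a')) (r : A.prof.El a' p) :
    A.prof.lact f (A.ptAct t r) = A.ptAct (A.prof.lact f t) r :=
  (A.prof.lact_ract _ _ _).trans (congrArg (A.prof.ract · (UltraFamily.leftUnit p))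
    (A.lact_multEl f t (ultraUnit A.prof r)))

theorem ptAct_unitEl' {a a' : A.carrier} {p : UltraFamily.{u} A.carrier} (f : a ⟶ a')
    (r : A.prof.El a' p) : A.ptAct (A.unitEl f) r = A.prof.lact f r := by
  have h : A.unitEl f = A.prof.lact f (A.unitEl (𝟙 a')) :=
    (congrArg A.unitEl (Category.comp_id f)).symm.trans (A.lact_unitEl f (𝟙 a')).symm
  rw [h]
  exact (A.lact_ptAct f _ r).symm.trans (congrArg (A.prof.lact f) (A.ptAct_unitEl r))

/-- The comparison functor from the carrier to the category of points, induced by the unitor. -/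
noncomputable def comparison : A.carrier ⥤ A.Pt where
  obj a := a
  map f := A.unitEl f
  map_id _ := rfl
  map_comp f g := by
    refine Eq.trans ?_ (A.ptAct_unitEl' f (A.unitEl g)).symm
    exact (A.lact_unitEl f g).symm

/-- The presheaf `A(-, p)` on the category of points. -/
noncomputable def ptPresheaf (p : UltraFamily.{u} A.carrier) : A.Ptᵒᵖ ⥤ Type u where
  obj a := A.prof.El a.unop p
  map t := ↾(fun r => A.ptAct t.unop r)
  map_id a := by ext r; exact A.ptAct_unitEl r
  map_comp t t' := by ext r; exact A.ptAct_assoc t'.unop t.unop r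

end LaxAlg

/-- A presheaf is small when it is a small colimit of representable presheaves. -/
def IsSmallPresheaf {C : Type v} [Category.{u} C] (P : Cᵒᵖ ⥤ Type u) : Prop :=
  ∃ (J : Type u) (_ : SmallCategory J) (F : J ⥤ C),
    Nonempty (P ≅ Limits.colimit (F ⋙ yoneda))

namespace LaxAlg

/-- The profunctor `A` is small: every presheaf `A(-, p)` on the carrier is small. -/
def IsSmall (A : LaxAlg.{u}) : Prop :=
  ∀ p : UltraFamily.{u} A.carrier, IsSmallPresheaf (A.prof.obj p)

/-- `A` is small over its points: every presheaf `A(-, p)` on the category of points is small. -/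
def IsPtSmall (A : LaxAlg.{u}) : Prop :=
  ∀ p : UltraFamily.{u} A.carrier, IsSmallPresheaf (A.ptPresheaf p)

/-- A lax algebra is discrete when its carrier is a discrete category. -/
def IsDisc : ObjectProperty LaxAlg.{u} := fun A => IsDiscrete A.carrier

/-- A lax algebra is normalized when its comparison functor is fully faithful. -/
def IsNormalized : ObjectProperty LaxAlg.{u} :=
  fun A => A.comparison.Full ∧ A.comparison.Faithful

/-- A representable colax morphism that is bijective on objects and on the elements of the
profunctors. -/
structure ColaxHom.IsBijective {A B : LaxAlg.{u}} (φ : ColaxHom A B) : Prop where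
  obj : Function.Bijective φ.functor.obj
  elements : ∀ (a : A.carrier) (p : UltraFamily.{u} A.carrier),
    Function.Bijective (fun r : A.prof.El a p => φ.onArrows r)

end LaxAlg

/-- Discrete lax algebras and representable colax morphisms. -/
abbrev DiscLaxAlg := LaxAlg.IsDisc.{u}.FullSubcategory

/-- Normalized lax algebras and representable colax morphisms. -/
abbrev NormLaxAlg := LaxAlg.IsNormalized.{u}.FullSubcategory

/-- A lax algebra whose class of objects is `X`. -/
structure LaxAlgOn (X : Type (u + 1)) where
  cat : Category.{u} X
  str : LaxAlgebra.{u} X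

namespace LaxAlgOn

variable {X : Type (u + 1)}

/-- The underlying lax algebra. -/
def toLaxAlg (A : LaxAlgOn.{u} X) : LaxAlg.{u} :=
  letI := A.cat
  ⟨X, A.str⟩

/-- A representable colax morphism between lax algebras on `X` is over `X` when it is the identity
on objects. -/
def IsOver {A B : LaxAlgOn.{u} X} (φ : A.toLaxAlg ⟶ B.toLaxAlg) : Prop :=
  ∀ x : X, (LaxAlg.ColaxHom.functor φ).obj x = x

/-- Isomorphism of lax algebras on `X` by an isomorphism over `X`. -/
instance setoid (X : Type (u + 1)) : Setoid (LaxAlgOn.{u} X) where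
  r A B := ∃ e : A.toLaxAlg ≅ B.toLaxAlg, IsOver e.hom
  iseqv :=
    { refl := fun A => ⟨Iso.refl _, fun _ => rfl⟩
      symm := fun {A B} ⟨e, h⟩ => ⟨e.symm, fun x => by
        have h₁ := congrArg (fun φ => (LaxAlg.ColaxHom.functor φ).obj x) e.hom_inv_id
        exact (congrArg (LaxAlg.ColaxHom.functor e.inv).obj (h x)).symm.trans h₁⟩
      trans := fun ⟨e, h⟩ ⟨e', h'⟩ => ⟨e ≪≫ e', fun x =>
        (congrArg (LaxAlg.ColaxHom.functor e'.hom).obj (h x)).trans (h' x)⟩ }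

end LaxAlgOn

/-- Discrete lax algebras with class of objects `X`. -/
def DiscOn (X : Type (u + 1)) := {A : LaxAlgOn.{u} X // LaxAlg.IsDisc A.toLaxAlg}

/-- Normalized lax algebras with class of objects `X`. -/
def NormOn (X : Type (u + 1)) := {A : LaxAlgOn.{u} X // LaxAlg.IsNormalized A.toLaxAlg}

/-- The discrete lax algebras with class of objects `X`, up to isomorphism over `X`. -/
def DiscClass (X : Type (u + 1)) :=
  _root_.Quotient ((LaxAlgOn.setoid.{u} X).comap (Subtype.val : DiscOn.{u} X → LaxAlgOn.{u} X))

/-- The normalized lax algebras with class of objects `X`, up to isomorphism over `X`. -/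
def NormClass (X : Type (u + 1)) :=
  _root_.Quotient ((LaxAlgOn.setoid.{u} X).comap (Subtype.val : NormOn.{u} X → LaxAlgOn.{u} X))

/-- The isomorphism class over `X`. -/
def DiscOn.toClass {X : Type (u + 1)} (A : DiscOn.{u} X) : DiscClass.{u} X :=
  _root_.Quotient.mk _ A

/-- The isomorphism class over `X`. -/
def NormOn.toClass {X : Type (u + 1)} (A : NormOn.{u} X) : NormClass.{u} X :=
  _root_.Quotient.mk _ A

/-- A discrete lax algebra on `X` as an object of the category of discrete lax algebras. -/
def DiscOn.toDiscLaxAlg {X : Type (u + 1)} (A : DiscOn.{u} X) : DiscLaxAlg.{u} :=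
  ⟨A.1.toLaxAlg, A.2⟩

/-- A normalized lax algebra on `X` as an object of the category of normalized lax algebras. -/
def NormOn.toNormLaxAlg {X : Type (u + 1)} (A : NormOn.{u} X) : NormLaxAlg.{u} :=
  ⟨A.1.toLaxAlg, A.2⟩

/-! A lax algebra `A` has more structure than its carrier shows. An element of `A(a, η a')`, a
morphism of points, acts on elements contravariantly by `ptAct`. A germ of such morphisms from `p`
to `q` acts covariantly by `act`: read the germ as an element of `𝛃̲ A` over the family of
singletons `(𝛃 η) q`, multiply by `Δ`, and remove the singletons by the right unit constraint.
Associativity with a layer of singletons makes the two actions commute and makes `Δ` natural and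
balanced for them (`multEl_ptAct`, `multEl_act`, `multEl_act_germ`). By the unit axioms and
naturality of `Γ`, both actions restrict along `Γ` to the old ones (`ptAct_unitEl'`,
`act_comparison`). So the same elements with the same `Δ` form a lax algebra `points` on the
category of points. Its unitor is the identity, whence it is normalized, and the identity on
elements is a morphism `toPoints` into it.

The carrier can thus be replaced while the elements stay. Restriction to the discrete category on
the same objects is one choice (`discretization`), the category of points is the other. A morphism
from `A` to a normalized `B` sends morphisms of points to morphisms of points, that is, to morphisms
of the carrier of `B`, so it extends to `A.points` (`extend`). If it is bijective on objects and
elements, the extension is an equivalence on carriers; if it is moreover the identity on objects,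
the extension is an isomorphism (`exists_iso_points`). Applied to the discretization of `B`, this
gives essential surjectivity, and surjectivity on classes over `X`.

A functor out of a discrete carrier is just a map of objects, so a morphism out of a discrete `A` is
determined by its effect on objects and elements. The same holds out of `A.points`, whose carrier
morphisms are themselves elements. Hence `points` is fully faithful on discrete lax algebras
(`pointsFunctor_map_injective`, `map_ofMapPoints`), and isomorphisms over `X` are reflected.

For smallness, `A(-, p)` on points is the restriction of a presheaf of `B` along an equivalence, and
small presheaves are stable under this. Over a discrete category a presheaf is small exactly when
its elements form a small set, a condition that does not see the morphisms of the category. -/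

/-! ### Coherence of the constraints of the pseudomonad `𝛃` -/

namespace UltraFamily

variable {C : Type v} [Category.{u} C]

/-- This and the next two identities simplify the constraint in the associativity axiom when one of
the three layers consists of singletons: outermost, middle and innermost, respectively. Each is an
equality of explicit reindexings with identity values. -/
theorem assoc_leftUnit_unit (P : UltraFamily.{u} (UltraFamily.{u} C)) :
    assoc ((unit _).obj P) ≫ (mult C).map (leftUnit P) = leftUnit ((mult C).obj P) := by
  have h : (mult C).map (leftUnit P) = _ :=
    sum_homMk (P := (mult _).obj ((unit _).obj P)) (Q := P) (fun y => ⟨PUnit.unit, y⟩) (by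
      apply Ultrafilter.coe_injective
      ext S
      rfl) fun y => ⟨id, Ultrafilter.map_id _, fun z => 𝟙 ((P.fam y).fam z)⟩
  rw [h]
  exact Germ.mk_eq' fun y => congrArg (Sigma.mk _) (Category.id_comp _)

theorem assoc_rightUnit_unit (P : UltraFamily.{u} (UltraFamily.{u} C)) :
    assoc ((mapFunctor (unit _)).obj P) ≫ (mult C).map (rightUnit P) =
      (mult C).map (homMk (p := (mapFunctor (unit _ ⋙ mult C)).obj P) (q := P) id
        (Ultrafilter.map_id _) fun y => leftUnit (P.fam y)) := by
  have h : (mult C).map (rightUnit P) = _ :=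
    sum_homMk (P := (mult _).obj ((mapFunctor (unit _)).obj P)) (Q := P)
      (fun y => ⟨y, PUnit.unit⟩) (by
      apply Ultrafilter.coe_injective
      ext S
      rfl) fun y => ⟨id, Ultrafilter.map_id _, fun z => 𝟙 ((P.fam y).fam z)⟩
  have h' := sum_homMk (P := (mapFunctor (unit _ ⋙ mult C)).obj P) (Q := P) id
    (Ultrafilter.map_id _) fun y => ⟨fun z => ⟨PUnit.unit, z⟩, by
        apply Ultrafilter.coe_injective
        ext S
        rfl, fun z => 𝟙 ((P.fam y).fam z)⟩
  refine Eq.trans ?_ h'.symm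
  rw [h]
  exact Germ.mk_eq' fun y => congrArg (Sigma.mk _) (Category.id_comp _)

theorem assoc_rightUnit (Q : UltraFamily.{u} (UltraFamily.{u} C)) :
    assoc ((mapFunctor (mapFunctor (unit C))).obj Q) ≫ rightUnit ((mult C).obj Q) =
      (mult C).map (homMk (p := (mapFunctor (mapFunctor (unit C) ⋙ mult C)).obj Q) (q := Q) id
        (Ultrafilter.map_id _) fun y => rightUnit (Q.fam y)) := by
  have h' := sum_homMk (P := (mapFunctor (mapFunctor (unit C) ⋙ mult C)).obj Q) (Q := Q) id
    (Ultrafilter.map_id _) fun y => ⟨fun z => ⟨z, PUnit.unit⟩, by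
        apply Ultrafilter.coe_injective
        ext S
        rfl, fun z => 𝟙 ((Q.fam y).fam z)⟩
  refine Eq.trans ?_ h'.symm
  exact Germ.mk_eq' fun y => congrArg (Sigma.mk _) (Category.id_comp _)

theorem leftUnit_naturality {p q : UltraFamily.{u} C} (f : p ⟶ q) :
    (mult C).map ((unit _).map f) ≫ leftUnit q = leftUnit p ≫ f := by
  obtain ⟨s, rfl⟩ := exists_rep f
  have h : (mult C).map ((unit _).map (Germ.mk s : HomGerm p q)) = _ :=
    sum_homMk (P := (unit _).obj p) (Q := (unit _).obj q) (fun _ => PUnit.unit)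
      (Ultrafilter.map_pure _ _) fun _ => s
  rw [h]
  exact Germ.mk_eq' fun y => congrArg (Sigma.mk _)
    ((Category.comp_id _).trans (Category.id_comp _).symm)

theorem rightUnit_naturality {p q : UltraFamily.{u} C} (f : p ⟶ q) :
    (mult C).map ((mapFunctor (unit C)).map f) ≫ rightUnit q = rightUnit p ≫ f := by
  obtain ⟨s, rfl⟩ := exists_rep f
  have h : (mult C).map ((mapFunctor (unit C)).map (Germ.mk s : HomGerm p q)) = _ :=
    sum_homMk (P := (mapFunctor (unit C)).obj p) (Q := (mapFunctor (unit C)).obj q) s.reindex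
      s.ult_map fun y => ⟨fun _ => PUnit.unit, Ultrafilter.map_pure _ _, fun _ => s.val y⟩
  rw [h]
  exact Germ.mk_eq' fun y => congrArg (Sigma.mk _)
    ((Category.comp_id _).trans (Category.id_comp _).symm)

end UltraFamily

/-! ### The two actions of morphisms of points on elements -/

namespace LaxAlg

variable (A : LaxAlg.{u})

theorem ptAct_ract {a a' : A.carrier} {p q : UltraFamily.{u} A.carrier}
    (t : A.prof.El a ((UltraFamily.unit A.carrier).obj a')) (r : A.prof.El a' p) (f : p ⟶ q) :
    A.ptAct t (A.prof.ract r f) = A.prof.ract (A.ptAct t r) f := by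
  have h : ultraUnit A.prof (A.prof.ract r f) =
      (ultra A.prof).ract (ultraUnit A.prof r) ((UltraFamily.unit _).map f) := rfl
  unfold ptAct
  rw [h, ← A.ract_multEl, ← ract_comp, ← ract_comp]
  exact congrArg (A.prof.ract _) (UltraFamily.leftUnit_naturality f)

/-- Associativity for `t`, the singleton family `r` and the singleton germ of `s`. Flattening the
last gives `s` back up to left unit constraints (`h₁`), and `assoc_leftUnit_unit` absorbs what
remains. -/
theorem multEl_ptAct {a a' : A.carrier} {p : UltraFamily.{u} A.carrier}
    {P : UltraFamily.{u} (UltraFamily.{u} A.carrier)}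
    (t : A.prof.El a ((UltraFamily.unit A.carrier).obj a')) (r : A.prof.El a' p)
    (s : (ultra A.prof).El p P) :
    A.multEl (A.ptAct t r) s = A.ptAct t (A.multEl r s) := by
  obtain ⟨s, rfl⟩ := Germ.exists_rep s
  have h := A.str.assoc t (ultraUnit A.prof r) (ultraUnit (ultra A.prof) (Germ.mk s))
  have e : ultraMult A.prof (ultraUnit (ultra A.prof) (Germ.mk s)) = _ :=
    Germ.sum_mk (F := A.prof.El) (P := (UltraFamily.unit _).obj p)
      (Q := (UltraFamily.unit _).obj P) (fun _ => PUnit.unit)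
      (Ultrafilter.map_pure _ _) fun _ => s
  have h₁ : (ultra A.prof).lact (UltraFamily.leftUnit p) (Germ.mk s) =
      (ultra A.prof).ract (c := (UltraFamily.mult _).obj ((UltraFamily.unit _).obj P))
        (ultraMult A.prof (ultraUnit (ultra A.prof) (Germ.mk s))) (UltraFamily.leftUnit P) := by
    rw [e]
    refine Germ.mk_eq' fun y => ?_
    exact congrArg (Sigma.mk _) ((A.prof.lact_id _).trans (A.prof.ract_id _).symm)
  refine (A.multEl_ract _ _ _).trans ((congrArg (A.multEl _) h₁).trans ?_)
  refine (A.ract_multEl _ _ _).symm.trans ?_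
  refine (congrArg (A.prof.ract · _) h.symm).trans ?_
  refine (ract_comp _ _ (UltraFamily.assoc _) _).symm.trans ?_
  exact congrArg (A.prof.ract _) (UltraFamily.assoc_leftUnit_unit P)

/-- A germ of morphisms of points as a germ of elements. -/
def hat {p q : UltraFamily.{u} A.carrier} (g : Germ (homEl A.Pt) p q) :
    (ultra A.prof).El p ((UltraFamily.mapFunctor (UltraFamily.unit _)).obj q) :=
  Germ.map (F := homEl A.Pt) (G := A.prof.El) id (UltraFamily.unit A.carrier).obj
    (fun _ _ x => x) g

/-- The covariant action of germs of morphisms of points on elements. -/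
noncomputable def act {a : A.carrier} {p q : UltraFamily.{u} A.carrier} (r : A.prof.El a p)
    (g : Germ (homEl A.Pt) p q) : A.prof.El a q :=
  A.prof.ract (A.multEl r (A.hat g)) (UltraFamily.rightUnit q)

theorem ptAct_act {a a' : A.carrier} {p q : UltraFamily.{u} A.carrier}
    (t : A.prof.El a ((UltraFamily.unit A.carrier).obj a')) (r : A.prof.El a' p)
    (g : Germ (homEl A.Pt) p q) : A.ptAct t (A.act r g) = A.act (A.ptAct t r) g := by
  unfold act
  rw [A.ptAct_ract, multEl_ptAct]

/-- This is the balancing condition that lets `Δ` descend to the coend over germs of morphisms of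
points. -/
theorem multEl_act {a : A.carrier} {p q : UltraFamily.{u} A.carrier}
    {P : UltraFamily.{u} (UltraFamily.{u} A.carrier)} (r : A.prof.El a p)
    (h : Germ (homEl A.Pt) p q) (s : (ultra A.prof).El q P) :
    A.multEl (A.act r h) s = A.multEl r
      (Germ.comp (G := homEl A.Pt) (F := A.prof.El) (H := A.prof.El)
        (fun _ _ _ t x => A.ptAct t x) h s) := by
  obtain ⟨h, rfl⟩ := Germ.exists_rep h
  obtain ⟨s, rfl⟩ := Germ.exists_rep s
  -- Each value of `s` is wrapped as a one-point germ, so that associativity applies to `r`, `A.hat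
  -- h`, `t`. The constraint then becomes a left unit in every fibre, and this fibrewise left unit
  -- turns the inner `Δ` into `ptAct`.
  let t : (ultra (ultra A.prof)).El ((UltraFamily.mapFunctor (UltraFamily.unit _)).obj q)
      ((UltraFamily.mapFunctor (UltraFamily.unit _)).obj P) :=
    Germ.map (F := A.prof.El) (G := (ultra A.prof).El) (UltraFamily.unit _).obj
      (UltraFamily.unit _).obj (fun _ _ x => ultraUnit A.prof x) (Germ.mk s)
  have ha := A.str.assoc r (A.hat (Germ.mk h)) t
  have e : ultraMult A.prof t = _ :=
    Germ.sum_mk (F := A.prof.El) (P := (UltraFamily.mapFunctor (UltraFamily.unit _)).obj q)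
      (Q := (UltraFamily.mapFunctor (UltraFamily.unit _)).obj P) s.reindex s.ult_map
      fun y => ⟨fun _ => PUnit.unit, Ultrafilter.map_pure _ _, fun _ => s.val y⟩
  have h₁ : (ultra A.prof).lact (UltraFamily.rightUnit q) (Germ.mk s) =
      (ultra A.prof).ract
        (c := (UltraFamily.mult _).obj ((UltraFamily.mapFunctor (UltraFamily.unit _)).obj P))
        (ultraMult A.prof t) (UltraFamily.rightUnit P) := by
    rw [e]
    refine Germ.mk_eq' fun y => ?_
    exact congrArg (Sigma.mk _) ((A.prof.lact_id _).trans (A.prof.ract_id _).symm)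
  refine (A.multEl_ract _ _ _).trans ((congrArg (A.multEl _) h₁).trans ?_)
  refine (A.ract_multEl _ _ _).symm.trans ?_
  refine (congrArg (A.prof.ract · _) ha.symm).trans ?_
  refine (ract_comp _ _ (UltraFamily.assoc _) _).symm.trans ?_
  refine (congrArg (A.prof.ract _) (UltraFamily.assoc_rightUnit_unit P)).trans ?_
  refine (A.ract_multEl _ _ _).trans ?_
  rfl

theorem act_act {a : A.carrier} {p q w : UltraFamily.{u} A.carrier} (r : A.prof.El a p)
    (f : Germ (homEl A.Pt) p q) (g : Germ (homEl A.Pt) q w) :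
    A.act (A.act r f) g = A.act r (Germ.comp (G := homEl A.Pt) (F := homEl A.Pt)
      (H := homEl A.Pt) (fun _ _ _ x y => x ≫ y) f g) := by
  unfold act
  refine congrArg (A.prof.ract · (UltraFamily.rightUnit w)) ((A.multEl_act _ _ _).trans ?_)
  obtain ⟨f, rfl⟩ := Germ.exists_rep f
  obtain ⟨g, rfl⟩ := Germ.exists_rep g
  rfl

/-- Naturality of `Δ` in its target family, now for germs of germs of morphisms of points. Here the
innermost layer of the associativity axiom is the one made of singletons, and the fibrewise right
units produce `act`. -/
theorem multEl_act_germ {a : A.carrier} {p : UltraFamily.{u} A.carrier}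
    {P Q : UltraFamily.{u} (UltraFamily.{u} A.carrier)} (r : A.prof.El a p)
    (s : (ultra A.prof).El p P)
    (g : Germ (fun x y => Germ (homEl A.Pt) x y) P Q) :
    A.multEl r (Germ.comp (G := A.prof.El) (F := fun x y => Germ (homEl A.Pt) x y)
        (H := A.prof.El) (fun _ _ _ x h => A.act x h) s g) =
      A.act (A.multEl r s) (Germ.sum g) := by
  obtain ⟨s, rfl⟩ := Germ.exists_rep s
  obtain ⟨⟨k, hk, g⟩, rfl⟩ := Germ.exists_rep g
  -- Representatives of all inner germs are chosen because `Germ.sum_mk` computes the flattening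
  -- only on them.
  obtain ⟨g, rfl⟩ : ∃ g' : ∀ y, GermRep (homEl A.Pt) (P.fam (k y)) (Q.fam y),
    g = fun y => Germ.mk (g' y) := ⟨fun y => (g y).out, funext fun y => (Germ.mk_out _).symm⟩
  let t : (ultra (ultra A.prof)).El P
      ((UltraFamily.mapFunctor (UltraFamily.mapFunctor (UltraFamily.unit _))).obj Q) :=
    Germ.mk (F := (ultra A.prof).El) (p := P)
      (q := (UltraFamily.mapFunctor (UltraFamily.mapFunctor (UltraFamily.unit _))).obj Q)
      ⟨k, hk, fun y => A.hat (Germ.mk (g y))⟩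
  have ha := A.str.assoc r (Germ.mk s) t
  have e : ultraMult A.prof t = A.hat (Germ.sum (Germ.mk ⟨k, hk, fun y => Germ.mk (g y)⟩)) := by
    refine (Germ.sum_mk (F := A.prof.El) (P := P)
      (Q := (UltraFamily.mapFunctor (UltraFamily.mapFunctor (UltraFamily.unit _))).obj Q) k hk
      fun y => ⟨(g y).reindex, (g y).ult_map, (g y).val⟩).trans ?_
    exact (congrArg A.hat (Germ.sum_mk k hk g)).symm
  refine Eq.symm ((congrArg (fun z => A.prof.ract (A.multEl (A.multEl r (Germ.mk s)) z)
    (UltraFamily.rightUnit ((UltraFamily.mult A.carrier).obj Q))) e.symm).trans ?_)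
  refine (congrArg (A.prof.ract · _) ha.symm).trans ?_
  refine (ract_comp _ _ (UltraFamily.assoc _) _).symm.trans ?_
  refine (congrArg (A.prof.ract _) (UltraFamily.assoc_rightUnit Q)).trans ?_
  refine (A.ract_multEl _ _ _).trans ?_
  rfl

/-- By naturality of `Γ`, the germ of the `Γ(f_y)` is the germ of the units transported along `f`;
the right unit axiom then removes the units. -/
theorem act_comparison {a : A.carrier} {p q : UltraFamily.{u} A.carrier} (r : A.prof.El a p)
    (f : p ⟶ q) : A.act r ((UltraFamily.mapFunctor A.comparison).map f) = A.prof.ract r f := by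
  have h : A.hat ((UltraFamily.mapFunctor A.comparison).map f) =
      (ultra A.prof).ract (A.str.unit.ultra (𝟙 p))
        ((UltraFamily.mapFunctor (UltraFamily.unit _)).map f) := by
    obtain ⟨s, rfl⟩ := UltraFamily.exists_rep f
    refine Germ.mk_eq' fun y => congrArg (Sigma.mk _) ?_
    exact ((A.ract_unitEl _ _).trans (congrArg A.unitEl (Category.id_comp (s.val y)))).symm
  refine (congrArg (fun z => A.prof.ract (A.multEl r z) (UltraFamily.rightUnit q)) h).trans ?_
  rw [← A.ract_multEl, ← ract_comp]
  refine (congrArg (A.prof.ract _) (UltraFamily.rightUnit_naturality f)).trans ?_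
  exact (ract_comp _ _ _ _).trans (congrArg (A.prof.ract · f) (A.str.unit_right r))

end LaxAlg

/-! ### The normalized lax algebra on the category of points -/

namespace LaxAlg

variable (A : LaxAlg.{u})

/-- The profunctor of `A`, acted on by the category of points. -/
noncomputable def pointsProf : Profunctor.{u} (UltraFamily.{u} A.Pt) A.Pt :=
  ofActions (fun a p => A.prof.El a p)
    (fun {a a' p} (t : A.prof.El a' ((UltraFamily.unit A.carrier).obj a))
      (r : A.prof.El a p) => A.ptAct t r)
    (fun {a p q} (r : A.prof.El a p) (g : UltraFamily.HomGerm p q) => A.act r g)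
    (fun r => A.ptAct_unitEl r)
    (fun t t' r => A.ptAct_assoc t t' r)
    (fun {a p} (r : A.prof.El a p) => A.str.unit_right r)
    (fun r f g => (A.act_act r f g).symm)
    (fun t r g => A.ptAct_act t r g)

/-- The unitor of `points`. -/
noncomputable def pointsUnit :
    Trans (Profunctor.id (C := A.Pt)) (UltraFamily.unit A.Pt ⋙ A.pointsProf) where
  app f := f
  app_lact _ _ := rfl
  -- On a one-point family the left and right unit constraints coincide definitionally, so
  -- composition of points is already a case of `act`.
  app_ract _ _ := rfl

/-- The multiplicator of `points`. -/
noncomputable def pointsMult :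
    Trans (coendComp A.pointsProf (ultra A.pointsProf)) (UltraFamily.mult A.Pt ⋙ A.pointsProf) :=
  Trans.ofPairs
    (fun {a p P} (r : A.prof.El a p) (s : (ultra A.prof).El p P) => A.multEl r s)
    (fun {a p q P} (r : A.prof.El a p) (h : UltraFamily.HomGerm p q)
      (s : (ultra A.prof).El q P) => A.multEl_act r h s)
    (fun t r s => A.multEl_ptAct t r s)
    (fun {a p P Q} (r : A.prof.El a p) (s : (ultra A.prof).El p P)
      (g : Germ (fun x y => Germ (homEl A.Pt) x y) P Q) => A.multEl_act_germ r s g)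

/-- The lax algebra structure on the category of points with the elements of `A`. -/
noncomputable def pointsStr : LaxAlgebra.{u} A.Pt where
  prof := A.pointsProf
  unit := A.pointsUnit
  mult := A.pointsMult
  -- The constraints over the category of points are the images of those over the carrier under `𝛃`
  -- of the comparison functor, because the identities of points are `Γ(1)`. Hence they act as
  -- before, and the axioms are those of `A`.
  unit_left {a p} r := (A.act_comparison (a := a)
    (p := (UltraFamily.mult A.carrier).obj ((UltraFamily.unit _).obj p)) _
      (UltraFamily.leftUnit (C := A.carrier) p)).trans (A.str.unit_left r)
  unit_right {a p} r := (A.act_comparison (a := a)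
    (p := (UltraFamily.mult A.carrier).obj ((UltraFamily.mapFunctor (UltraFamily.unit _)).obj p)) _
      (UltraFamily.rightUnit (C := A.carrier) p)).trans (A.str.unit_right r)
  assoc {a W P Q} r s t := by
    refine (A.act_comparison (a := a) (p := (UltraFamily.mult A.carrier).obj
      ((UltraFamily.mapFunctor (UltraFamily.mult A.carrier)).obj Q)) _
      (UltraFamily.assoc (C := A.carrier) Q)).trans ?_
    refine Eq.trans ?_ (A.str.assoc (W := W) (P := P) (Q := Q) r s t)
    obtain ⟨s, rfl⟩ := Germ.exists_rep s
    obtain ⟨t, rfl⟩ := Germ.exists_rep t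
    rfl

/-- The lax algebra on the category of points with the elements of `A`. -/
noncomputable def points : LaxAlg.{u} := ⟨A.Pt, A.pointsStr⟩

theorem points_isNormalized : IsNormalized A.points :=
  ⟨⟨fun f => ⟨f, rfl⟩⟩, ⟨fun h => h⟩⟩

/-- The canonical morphism from `A` to the lax algebra on its category of points. -/
noncomputable def toPoints : A ⟶ A.points :=
  ColaxHom.ofOnArrows (A := A) (B := A.points) A.comparison
    (fun r => r)
    (fun f r => (A.ptAct_unitEl' f r).symm)
    (fun r g => (A.act_comparison r g).symm)
    (fun _ => rfl)
    (fun r s => by obtain ⟨s, rfl⟩ := Germ.exists_rep s; rfl)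

theorem toPoints_onArrows {a : A.carrier} {p : UltraFamily.{u} A.carrier} (r : A.prof.El a p) :
    ColaxHom.onArrows (A := A) (B := A.points) A.toPoints r = r :=
  ColaxHom.onArrows_ofOnArrows _ _ _ _ _ _ r

theorem toPoints_isBijective : ColaxHom.IsBijective A.toPoints where
  obj := Function.bijective_id
  elements _ _ := ⟨fun r r' h => (A.toPoints_onArrows r).symm.trans
    (h.trans (A.toPoints_onArrows r')), fun r => ⟨r, A.toPoints_onArrows r⟩⟩

/-! ### Morphisms respect the two actions -/

namespace ColaxHom

variable {A : LaxAlg.{u}} {B : LaxAlg.{u}} (φ : ColaxHom A B)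

/-- The action is built from `Δ` and a constraint with identity values; a morphism preserves the
first by its axiom and the second because its functor preserves identities. -/
theorem onArrows_ptAct {a a' : A.carrier} {p : UltraFamily.{u} A.carrier}
    (t : A.prof.El a ((UltraFamily.unit A.carrier).obj a')) (r : A.prof.El a' p) :
    φ.onArrows (A.ptAct t r) = B.ptAct (φ.onArrows t) (φ.onArrows r) := by
  refine (φ.onArrows_ract _ _).trans ?_
  refine congrArg₂ (B.prof.ract (c := (UltraFamily.mult _).obj ((UltraFamily.unit _).obj
    ((UltraFamily.mapFunctor φ.functor).obj p)))) (φ.onArrows_mult _ _) ?_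
  exact Germ.mk_eq' fun y => congrArg (Sigma.mk _) (φ.functor.map_id _)

/-- The action on germs of morphisms of points. -/
def onPtGerms {p q : UltraFamily.{u} A.carrier} (g : Germ (homEl A.Pt) p q) :
    Germ (homEl B.Pt) ((UltraFamily.mapFunctor φ.functor).obj p)
      ((UltraFamily.mapFunctor φ.functor).obj q) :=
  Germ.map (F := homEl A.Pt) (G := homEl B.Pt) φ.functor.obj φ.functor.obj
    (fun _ _ t => φ.onArrows t) g

theorem onArrows_act {a : A.carrier} {p q : UltraFamily.{u} A.carrier} (r : A.prof.El a p)
    (g : Germ (homEl A.Pt) p q) :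
    φ.onArrows (A.act r g) = B.act (φ.onArrows r) (φ.onPtGerms g) := by
  refine (φ.onArrows_ract _ _).trans ?_
  obtain ⟨g, rfl⟩ := Germ.exists_rep g
  refine congrArg₂ (B.prof.ract (c := (UltraFamily.mult _).obj ((UltraFamily.mapFunctor
    (UltraFamily.unit _)).obj ((UltraFamily.mapFunctor φ.functor).obj q))))
      (φ.onArrows_mult _ _) ?_
  exact Germ.mk_eq' fun y => congrArg (Sigma.mk _) (φ.functor.map_id _)

/-- The functor between categories of points. -/
noncomputable def ptFunctor : A.Pt ⥤ B.Pt where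
  obj a := φ.functor.obj a
  map {a a'} (t : A.prof.El a ((UltraFamily.unit A.carrier).obj a')) := φ.onArrows t
  map_id a := φ.onArrows_unit a
  map_comp t t' := φ.onArrows_ptAct t t'

/-- The morphism between lax algebras on categories of points. -/
noncomputable def mapPoints : A.points ⟶ B.points :=
  ColaxHom.ofOnArrows (A := A.points) (B := B.points) φ.ptFunctor
    (fun {a p} (r : A.prof.El a p) => φ.onArrows r)
    (fun t r => φ.onArrows_ptAct t r)
    (fun r g => φ.onArrows_act r g)
    (fun a => φ.onArrows_unit a)
    (fun r s => φ.onArrows_mult r s)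

theorem mapPoints_onArrows {a : A.carrier} {p : UltraFamily.{u} A.carrier} (r : A.prof.El a p) :
    ColaxHom.onArrows (A := A.points) (B := B.points) φ.mapPoints r = φ.onArrows r :=
  ColaxHom.onArrows_ofOnArrows (A := A.points) (B := B.points) _ _ _ _ _ _ r

end ColaxHom

end LaxAlg

/-! ### Restriction along a functor, and discretization -/

namespace UltraFamily

variable {C : Type v} [Category.{u} C] {D : Type v₁} [Category.{u} D] (f : C ⥤ D)

/-- The functors `𝛃 f` commute strictly with `μ` and, by the lemmas below, with the constraints.
This is why the axioms of a restricted lax algebra are instances of the original axioms. -/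
theorem mult_naturality {P Q : UltraFamily.{u} (UltraFamily.{u} C)} (g : P ⟶ Q) :
    (mapFunctor f).map ((mult C).map g) = (mult D).map ((mapFunctor (mapFunctor f)).map g) := by
  obtain ⟨i, hi, s, rfl⟩ := exists_homMk₂ g
  rw [show (mult C).map (homMk i hi fun y => (Germ.mk (s y) : HomGerm (P.fam (i y)) (Q.fam y))) = _
    from sum_homMk i hi s]
  exact (sum_homMk (P := (mapFunctor (mapFunctor f)).obj P)
    (Q := (mapFunctor (mapFunctor f)).obj Q) i hi
    fun y => ⟨(s y).reindex, (s y).ult_map, fun z => f.map ((s y).val z)⟩).symm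

theorem map_leftUnit (p : UltraFamily.{u} C) :
    (mapFunctor f).map (leftUnit p) = leftUnit ((mapFunctor f).obj p) :=
  Germ.mk_eq' fun _ => congrArg (Sigma.mk _) (f.map_id _)

theorem map_rightUnit (p : UltraFamily.{u} C) :
    (mapFunctor f).map (rightUnit p) = rightUnit ((mapFunctor f).obj p) :=
  Germ.mk_eq' fun _ => congrArg (Sigma.mk _) (f.map_id _)

theorem map_assoc (Q : UltraFamily.{u} (UltraFamily.{u} (UltraFamily.{u} C))) :
    (mapFunctor f).map (assoc Q) =
      assoc ((mapFunctor (mapFunctor (mapFunctor f))).obj Q) :=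
  Germ.mk_eq' fun _ => congrArg (Sigma.mk _) (f.map_id _)

end UltraFamily

namespace LaxAlg

section Pullback

variable (B : LaxAlg.{u}) {C : Type (u + 1)} [Category.{u} C] (f : C ⥤ B.carrier)

/-- The restriction of the profunctor of `B` along a functor. -/
def pullbackProf : Profunctor.{u} (UltraFamily.{u} C) C :=
  ofActions (fun c p => B.prof.El (f.obj c) ((UltraFamily.mapFunctor f).obj p))
    (fun k r => B.prof.lact (f.map k) r)
    (fun r g => B.prof.ract r ((UltraFamily.mapFunctor f).map g))
    (fun r => by rw [f.map_id]; exact B.prof.lact_id r)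
    (fun k k' r => by rw [f.map_comp]; exact B.prof.lact_comp _ _ r)
    (fun r => by rw [(UltraFamily.mapFunctor f).map_id]; exact B.prof.ract_id r)
    (fun r g g' => by rw [(UltraFamily.mapFunctor f).map_comp]; exact B.prof.ract_comp r _ _)
    (fun k r g => B.prof.lact_ract _ r _)

/-- The germs of elements of the restriction as germs of elements of `B`. -/
def pullbackGerm {p : UltraFamily.{u} C} {P : UltraFamily.{u} (UltraFamily.{u} C)}
    (s : (ultra (B.pullbackProf f)).El p P) :
    (ultra B.prof).El ((UltraFamily.mapFunctor f).obj p)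
      ((UltraFamily.mapFunctor (UltraFamily.mapFunctor f)).obj P) :=
  Germ.map (F := (B.pullbackProf f).El) (G := B.prof.El) f.obj (UltraFamily.mapFunctor f).obj
    (fun _ _ x => x) s

/-- The composition of the restriction. -/
noncomputable def pullbackMultEl {c : C} {p : UltraFamily.{u} C} {P : UltraFamily.{u} (UltraFamily.{u} C)}
    (r : (B.pullbackProf f).El c p) (s : (ultra (B.pullbackProf f)).El p P) :
    (B.pullbackProf f).El c ((UltraFamily.mult C).obj P) :=
  B.multEl (P := (UltraFamily.mapFunctor (UltraFamily.mapFunctor f)).obj P)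
    (show B.prof.El (f.obj c) ((UltraFamily.mapFunctor f).obj p) from r) (B.pullbackGerm f s)

/-- The unitor of the restriction. -/
noncomputable def pullbackUnit :
    Trans (Profunctor.id (C := C)) (UltraFamily.unit C ⋙ B.pullbackProf f) where
  app {c c'} (k : c ⟶ c') := B.unitEl (f.map k)
  app_lact {c c' c''} (k : c' ⟶ c) (k' : c ⟶ c'') :=
    (congrArg B.unitEl (f.map_comp k k')).trans (B.lact_unitEl _ _).symm
  app_ract {c c' c''} (k : c ⟶ c') (k' : c' ⟶ c'') :=
    (congrArg B.unitEl (f.map_comp k k')).trans (B.ract_unitEl _ _).symm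

/-- The multiplicator of the restriction. -/
noncomputable def pullbackMult :
    Trans (coendComp (B.pullbackProf f) (ultra (B.pullbackProf f)))
      (UltraFamily.mult C ⋙ B.pullbackProf f) :=
  Trans.ofPairs (fun r s => B.pullbackMultEl f r s)
    (fun {c p q P} r h s => by
      obtain ⟨s, rfl⟩ := Germ.exists_rep s
      obtain ⟨h, rfl⟩ := UltraFamily.exists_rep h
      exact B.multEl_ract _ _ _)
    (fun k r s => (B.lact_multEl (f.map k) _ _).symm)
    (fun {c p P Q} r s g => by
      refine Eq.trans ?_ (congrArg (B.prof.ract _) (UltraFamily.mult_naturality f g)).symm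
      refine Eq.trans ?_ (B.ract_multEl
        (P := (UltraFamily.mapFunctor (UltraFamily.mapFunctor f)).obj P)
        (Q := (UltraFamily.mapFunctor (UltraFamily.mapFunctor f)).obj Q) _ _ _).symm
      obtain ⟨s, rfl⟩ := Germ.exists_rep s
      obtain ⟨g, rfl⟩ := UltraFamily.exists_rep g
      rfl)

/-- The restriction of a lax algebra structure along a functor. -/
noncomputable def pullbackStr : LaxAlgebra.{u} C where
  prof := B.pullbackProf f
  unit := B.pullbackUnit f
  mult := B.pullbackMult f
  unit_left {a p} r := by
    refine (congrArg₂ (B.prof.ract (c := (UltraFamily.mult _).obj ((UltraFamily.unit _).obj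
      ((UltraFamily.mapFunctor f).obj p)))) ?_ (UltraFamily.map_leftUnit f p)).trans
      (B.str.unit_left (p := (UltraFamily.mapFunctor f).obj p) r)
    exact congrArg (fun k => B.multEl (B.unitEl k) (ultraUnit B.prof
      (c := (UltraFamily.mapFunctor f).obj p) r)) (f.map_id a)
  unit_right {a p} r := by
    refine (congrArg₂ (B.prof.ract (c := (UltraFamily.mult _).obj ((UltraFamily.mapFunctor
      (UltraFamily.unit _)).obj ((UltraFamily.mapFunctor f).obj p)))) ?_
      (UltraFamily.map_rightUnit f p)).trans
      (B.str.unit_right (p := (UltraFamily.mapFunctor f).obj p) r)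
    refine congrArg (B.multEl (P := (UltraFamily.mapFunctor (UltraFamily.unit _)).obj
      ((UltraFamily.mapFunctor f).obj p)) _) ?_
    exact Germ.mk_eq' fun y => congrArg (Sigma.mk _) (congrArg B.unitEl (f.map_id (p.fam y)))
  assoc {a W P Q} r s t := by
    obtain ⟨s, rfl⟩ := Germ.exists_rep s
    obtain ⟨⟨k, hk, t⟩, rfl⟩ := Germ.exists_rep t
    obtain ⟨t, rfl⟩ : ∃ t' : ∀ y, GermRep (B.pullbackProf f).El (P.fam (k y)) (Q.fam y),
      t = fun y => Germ.mk (t' y) := ⟨fun y => Germ.out (t y), funext fun y => (Germ.mk_out _).symm⟩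
    have h := B.str.assoc (W := (UltraFamily.mapFunctor f).obj W)
      (P := (UltraFamily.mapFunctor (UltraFamily.mapFunctor f)).obj P)
      (Q := (UltraFamily.mapFunctor (UltraFamily.mapFunctor (UltraFamily.mapFunctor f))).obj Q)
      r (B.pullbackGerm f (Germ.mk s)) (Germ.mk (F := (ultra B.prof).El)
        (p := (UltraFamily.mapFunctor (UltraFamily.mapFunctor f)).obj P)
        (q := (UltraFamily.mapFunctor (UltraFamily.mapFunctor (UltraFamily.mapFunctor f))).obj Q)
        ⟨k, hk, fun y => B.pullbackGerm f (Germ.mk (t y))⟩)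
    refine (congrArg (B.prof.ract _) (UltraFamily.map_assoc f Q)).trans (h.trans ?_)
    refine congrArg (B.multEl (P := (UltraFamily.mult _).obj ((UltraFamily.mapFunctor
      (UltraFamily.mapFunctor (UltraFamily.mapFunctor f))).obj Q)) _) ?_
    refine (Germ.sum_mk (F := B.prof.El)
      (P := (UltraFamily.mapFunctor (UltraFamily.mapFunctor f)).obj P)
      (Q := (UltraFamily.mapFunctor (UltraFamily.mapFunctor (UltraFamily.mapFunctor f))).obj Q)
      k hk fun y => ⟨(t y).reindex, (t y).ult_map, (t y).val⟩).trans ?_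
    exact (congrArg (B.pullbackGerm f) (Germ.sum_mk k hk t)).symm

/-- The restriction of a lax algebra along a functor. -/
noncomputable def pullback : LaxAlg.{u} := ⟨C, B.pullbackStr f⟩

/-- The morphism from the restriction to the lax algebra. -/
noncomputable def ofPullback : B.pullback f ⟶ B :=
  ColaxHom.ofOnArrows (A := B.pullback f) (B := B) f
    (fun {a p} (r : B.prof.El (f.obj a) ((UltraFamily.mapFunctor f).obj p)) => r)
    (fun _ _ => rfl)
    (fun _ _ => rfl)
    (fun a => congrArg B.unitEl (f.map_id a))
    (fun r s => by obtain ⟨s, rfl⟩ := Germ.exists_rep s; rfl)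

theorem ofPullback_onArrows {c : C} {p : UltraFamily.{u} C} (r : (B.pullback f).prof.El c p) :
    ColaxHom.onArrows (A := B.pullback f) (B := B) (B.ofPullback f) r = r :=
  ColaxHom.onArrows_ofOnArrows (A := B.pullback f) (B := B) _ _ _ _ _ _ r

end Pullback

/-- The category with class of objects `X` and only identity morphisms. -/
@[reducible]
def discCat (X : Type v) : Category.{w} X where
  Hom x y := ULift (PLift (x = y))
  id _ := ⟨⟨rfl⟩⟩
  comp f g := ⟨⟨f.down.down.trans g.down.down⟩⟩

theorem discCat_isDiscrete (X : Type v) : @IsDiscrete X (discCat.{v, w} X) :=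
  letI := discCat.{v, w} X
  { subsingleton := fun _ _ => ⟨fun ⟨⟨_⟩⟩ ⟨⟨_⟩⟩ => rfl⟩
    eq_of_hom := fun f => f.down.down }

/-- The functor from the discrete category that is the identity on objects. -/
@[reducible]
def discFunctor (X : Type v) (cat : Category.{w} X) : @CategoryTheory.Functor X (discCat.{v, w} X) X cat :=
  letI : Category.{w} X := cat
  @CategoryTheory.Functor.mk X (discCat.{v, w} X) X cat
    (fun x => x) (fun f => eqToHom f.down.down)
    (fun _ => rfl) (fun f g => (eqToHom_trans f.down.down g.down.down).symm)

/-- The discrete lax algebra with the objects and elements of `B`. -/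
noncomputable def discretization (B : LaxAlg.{u}) : LaxAlg.{u} :=
  letI := discCat.{u + 1, u} B.carrier
  B.pullback (C := B.carrier) (discFunctor B.carrier B.cat)

theorem discretization_isDisc (B : LaxAlg.{u}) : IsDisc B.discretization :=
  discCat_isDiscrete B.carrier

/-- The morphism from the discretization that is the identity on objects and elements. -/
noncomputable def ofDiscretization (B : LaxAlg.{u}) : B.discretization ⟶ B :=
  letI := discCat.{u + 1, u} B.carrier
  B.ofPullback (discFunctor B.carrier B.cat)

theorem ofDiscretization_isBijective (B : LaxAlg.{u}) :
    ColaxHom.IsBijective B.ofDiscretization :=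
  letI := discCat.{u + 1, u} B.carrier
  { obj := Function.bijective_id
    elements := fun _ _ =>
      ⟨fun r r' h => (B.ofPullback_onArrows (discFunctor B.carrier B.cat) r).symm.trans
        (h.trans (B.ofPullback_onArrows (discFunctor B.carrier B.cat) r')),
        fun r => ⟨r, B.ofPullback_onArrows (discFunctor B.carrier B.cat) r⟩⟩ }

end LaxAlg

/-! ### Functoriality of `points` and naturality of `toPoints` -/

namespace LaxAlg

theorem idHom_onArrows {A : LaxAlg.{u}} {a : A.carrier} {p : UltraFamily.{u} A.carrier}
    (r : A.prof.El a p) : ColaxHom.onArrows (𝟙 A : A ⟶ A) r = r :=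
  A.prof.lact_id r

theorem comp_onArrows {A B C : LaxAlg.{u}} (φ : A ⟶ B) (ψ : B ⟶ C) {a : A.carrier}
    {p : UltraFamily.{u} A.carrier} (r : A.prof.El a p) :
    ColaxHom.onArrows (φ ≫ ψ) r = ColaxHom.onArrows ψ (ColaxHom.onArrows φ r) :=
  C.prof.lact_id (ColaxHom.onArrows ψ (ColaxHom.onArrows φ r))

/-- The construction of `points` as a functor. -/
noncomputable def pointsFunctor : LaxAlg.{u} ⥤ LaxAlg.{u} where
  obj A := A.points
  map φ := ColaxHom.mapPoints φ
  map_id A := ColaxHom.ext_onArrows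
    (CategoryTheory.Functor.hext (fun _ => rfl) fun _ _ t => heq_of_eq (idHom_onArrows (A := A) t))
    fun _ _ r => heq_of_eq <| (ColaxHom.mapPoints_onArrows (𝟙 A : A ⟶ A) r).trans
      ((idHom_onArrows (A := A) r).trans (idHom_onArrows (A := A.points) r).symm)
  map_comp {A B C} φ ψ := ColaxHom.ext_onArrows
    (CategoryTheory.Functor.hext (fun _ => rfl) fun _ _ t => heq_of_eq (comp_onArrows φ ψ t))
    fun _ _ r => heq_of_eq <| (ColaxHom.mapPoints_onArrows (φ ≫ ψ) r).trans
      ((comp_onArrows φ ψ r).trans <| Eq.symm <|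
        (comp_onArrows (A := A.points) (B := B.points) (C := C.points)
          (ColaxHom.mapPoints φ) (ColaxHom.mapPoints ψ) r).trans
        ((congrArg _ (ColaxHom.mapPoints_onArrows φ r)).trans
          (ColaxHom.mapPoints_onArrows ψ _)))

/-- Compatibility with `Γ` is imposed essentially at identities; the contravariant action of `f` on
`Γ(1)` gives the rest. When the unitors are identities, as for `points`, it follows that the action
on elements determines the functor on morphisms. -/
theorem ColaxHom.onArrows_unitEl {A B : LaxAlg.{u}} (φ : ColaxHom A B) {a a' : A.carrier}
    (f : a ⟶ a') : φ.onArrows (A.unitEl f) = B.unitEl (φ.functor.map f) := by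
  have h := φ.onArrows_lact f (A.unitEl (𝟙 a'))
  rw [A.lact_unitEl, Category.comp_id, onArrows_unit] at h
  exact h.trans ((B.lact_unitEl _ _).trans (congrArg B.unitEl (Category.comp_id _)))

theorem toPoints_naturality {A B : LaxAlg.{u}} (φ : A ⟶ B) :
    φ ≫ B.toPoints = A.toPoints ≫ pointsFunctor.map φ :=
  ColaxHom.ext_onArrows
    (CategoryTheory.Functor.hext (fun _ => rfl) fun a a' f =>
      heq_of_eq (ColaxHom.onArrows_unitEl φ f).symm)
    fun a p r => heq_of_eq <| by
      refine (comp_onArrows φ B.toPoints r).trans ((B.toPoints_onArrows _).trans ?_)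
      refine Eq.symm ((comp_onArrows A.toPoints (pointsFunctor.map φ) r).trans ?_)
      exact (congrArg _ (A.toPoints_onArrows r)).trans (ColaxHom.mapPoints_onArrows φ r)

/-- The canonical transformation to `pointsFunctor`. -/
noncomputable def toPointsNat : 𝟭 LaxAlg.{u} ⟶ pointsFunctor where
  app A := A.toPoints
  naturality _ _ φ := toPoints_naturality φ

/-! ### Extension of a morphism to a normalized lax algebra along `toPoints` -/

section Extension

variable {A B : LaxAlg.{u}} (hB : IsNormalized B) (ψ : ColaxHom A B)

/-- The functor on points to a normalized lax algebra. -/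
noncomputable def extendFunctor : A.Pt ⥤ B.carrier :=
  haveI := hB.1
  haveI := hB.2
  { obj := fun a => ψ.functor.obj a
    -- The image of `t` is a morphism of points of `B`; since `B` is normalized, it is `Γ` of
    -- exactly one morphism of the carrier.
    map := fun {a a'} t => B.comparison.preimage (X := ψ.functor.obj a) (Y := ψ.functor.obj a')
      (ψ.ptFunctor.map t)
    map_id := fun a => B.comparison.map_injective <|
      (B.comparison.map_preimage _).trans ((ψ.ptFunctor.map_id a).trans
        (B.comparison.map_id _).symm)
    map_comp := fun t t' => B.comparison.map_injective <|
      (B.comparison.map_preimage _).trans ((ψ.ptFunctor.map_comp t t').trans <| Eq.symm <|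
        (B.comparison.map_comp _ _).trans <|
          congrArg₂ _ (B.comparison.map_preimage _) (B.comparison.map_preimage _)) }

theorem unitEl_extendFunctor {a a' : A.Pt} (t : a ⟶ a') :
    B.unitEl ((extendFunctor hB ψ).map t) = ψ.ptFunctor.map t :=
  have := hB.1
  B.comparison.map_preimage _

/-- The extension of a morphism to a normalized lax algebra along `toPoints`. -/
noncomputable def extend : A.points ⟶ B :=
  ColaxHom.ofOnArrows (A := A.points) (B := B) (extendFunctor hB ψ)
    (fun {a p} (r : A.prof.El a p) => ψ.onArrows r)
    (fun {a a' p} t r => by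
      refine (ψ.onArrows_ptAct t r).trans ?_
      refine Eq.trans ?_ (B.ptAct_unitEl' _ _)
      exact congrArg (B.ptAct · (ψ.onArrows (a := a) (p := p) r))
        (unitEl_extendFunctor hB ψ t).symm)
    (fun {a p q} r g => by
      refine (ψ.onArrows_act r g).trans ?_
      refine Eq.trans ?_ (B.act_comparison
        (ψ.onArrows (a := a) (p := p) r) ((UltraFamily.mapFunctor (extendFunctor hB ψ)).map g))
      refine congrArg (B.act (ψ.onArrows (a := a) (p := p) r)) ?_
      obtain ⟨g, rfl⟩ := UltraFamily.exists_rep g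
      exact Germ.mk_eq' fun y => congrArg (Sigma.mk _) (unitEl_extendFunctor hB ψ (g.val y)).symm)
    (fun a => ψ.onArrows_unit a)
    (fun r s => ψ.onArrows_mult r s)

theorem extend_onArrows {a : A.carrier} {p : UltraFamily.{u} A.carrier} (r : A.prof.El a p) :
    ColaxHom.onArrows (A := A.points) (B := B) (extend hB ψ) r = ψ.onArrows r :=
  ColaxHom.onArrows_ofOnArrows (A := A.points) (B := B) _ _ _ _ _ _ r

variable {ψ}

theorem extend_isBijective (hψ : ψ.IsBijective) : ColaxHom.IsBijective (extend hB ψ) where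
  obj := hψ.obj
  elements a p := by
    have h := hψ.elements a p
    exact ⟨fun r r' e => h.1 ((extend_onArrows hB ψ r).symm.trans
      (e.trans (extend_onArrows hB ψ r'))), fun x => (h.2 x).imp fun r e =>
        (extend_onArrows hB ψ r).trans e⟩

/-- Morphisms of points are elements at one-point families, so bijectivity on elements at these
families gives faithfulness here and fullness below. -/
theorem extendFunctor_faithful (hψ : ψ.IsBijective) : (extendFunctor hB ψ).Faithful where
  map_injective {a a'} t t' h := (hψ.elements a ((UltraFamily.unit A.carrier).obj a')).1 <|
    (unitEl_extendFunctor hB ψ t).symm.trans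
      ((congrArg B.unitEl h).trans (unitEl_extendFunctor hB ψ t'))

theorem extendFunctor_full (hψ : ψ.IsBijective) : (extendFunctor hB ψ).Full where
  map_surjective {a a'} f := by
    have := hB.2
    obtain ⟨t, ht⟩ := (hψ.elements a ((UltraFamily.unit A.carrier).obj a')).2 (B.unitEl f)
    exact ⟨t, B.comparison.map_injective ((unitEl_extendFunctor hB ψ t).trans ht)⟩

theorem extendFunctor_isEquivalence (hψ : ψ.IsBijective) : (extendFunctor hB ψ).IsEquivalence where
  faithful := extendFunctor_faithful hB hψ
  full := extendFunctor_full hB hψ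
  essSurj := ⟨fun b => (hψ.obj.2 b).imp fun _ h => ⟨eqToIso h⟩⟩

end Extension

/-! ### Isomorphisms versus bijective morphisms -/

theorem ColaxHom.onArrows_heq {A B : LaxAlg.{u}} (φ : ColaxHom A B) {a a' : A.carrier}
    {p p' : UltraFamily.{u} A.carrier} (ha : a = a') (hp : p = p') {r : A.prof.El a p}
    {r' : A.prof.El a' p'} (hr : HEq r r') : HEq (φ.onArrows r) (φ.onArrows r') := by
  subst ha hp
  obtain rfl := eq_of_heq hr
  rfl

theorem ColaxHom.onArrows_heq_of_eq {A B : LaxAlg.{u}} {φ ψ : ColaxHom A B} (h : φ = ψ)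
    {a : A.carrier} {p : UltraFamily.{u} A.carrier} (r : A.prof.El a p) :
    HEq (φ.onArrows r) (ψ.onArrows r) := by
  subst h
  rfl

/-- The composite functor equals the identity only propositionally, so the two elements live in
different types and are compared by `HEq`. -/
theorem iso_hom_inv_onArrows {A B : LaxAlg.{u}} (e : A ≅ B) {a : A.carrier}
    {p : UltraFamily.{u} A.carrier} (r : A.prof.El a p) :
    HEq (ColaxHom.onArrows e.inv (ColaxHom.onArrows e.hom r)) r := by
  have h := ColaxHom.onArrows_heq_of_eq e.hom_inv_id r
  exact (heq_of_eq (comp_onArrows e.hom e.inv r)).symm.trans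
    (h.trans (heq_of_eq (idHom_onArrows r)))

theorem iso_hom_inv_functor {A B : LaxAlg.{u}} (e : A ≅ B) :
    ColaxHom.functor e.hom ⋙ ColaxHom.functor e.inv = 𝟭 A.carrier :=
  congrArg ColaxHom.functor e.hom_inv_id

theorem isBijective_of_iso {A B : LaxAlg.{u}} (e : A ≅ B) : ColaxHom.IsBijective e.hom where
  obj := ⟨fun a a' h => by
      have h₁ := fun x => CategoryTheory.Functor.congr_obj (iso_hom_inv_functor e) x
      exact (h₁ a).symm.trans ((congrArg (ColaxHom.functor e.inv).obj h).trans (h₁ a')),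
    fun b => ⟨(ColaxHom.functor e.inv).obj b,
      CategoryTheory.Functor.congr_obj (iso_hom_inv_functor e.symm) b⟩⟩
  elements a p := by
    refine ⟨fun r r' h => eq_of_heq <| (iso_hom_inv_onArrows e r).symm.trans <|
      (heq_of_eq (congrArg _ h)).trans (iso_hom_inv_onArrows e r'), fun x => ?_⟩
    have ha : (ColaxHom.functor e.inv).obj ((ColaxHom.functor e.hom).obj a) = a :=
      CategoryTheory.Functor.congr_obj (iso_hom_inv_functor e) a
    have hp : (UltraFamily.mapFunctor (ColaxHom.functor e.inv)).obj
        ((UltraFamily.mapFunctor (ColaxHom.functor e.hom)).obj p) = p :=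
      congrArg (fun F : A.carrier ⥤ A.carrier => (UltraFamily.mapFunctor F).obj p)
        (iso_hom_inv_functor e)
    have ht : A.prof.El _ _ = A.prof.El a p := congrArg₂ (fun a p => A.prof.El a p) ha hp
    -- The inverse image of `x` lies over the round trips of `a` and `p`, and has to be transported
    -- to `a` and `p` themselves.
    refine ⟨cast ht (ColaxHom.onArrows e.inv x), eq_of_heq ?_⟩
    exact (ColaxHom.onArrows_heq e.hom ha.symm hp.symm (cast_heq ht _)).trans
      (iso_hom_inv_onArrows e.symm x)

theorem IsBijective.comp {A B C : LaxAlg.{u}} {φ : A ⟶ B} {ψ : B ⟶ C}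
    (hφ : ColaxHom.IsBijective φ) (hψ : ColaxHom.IsBijective ψ) :
    ColaxHom.IsBijective (φ ≫ ψ) where
  obj := hψ.obj.comp hφ.obj
  elements a p := by
    have h := (hψ.elements _ _).comp (hφ.elements a p)
    exact ⟨fun r r' e => h.1 ((comp_onArrows φ ψ r).symm.trans (e.trans (comp_onArrows φ ψ r'))),
      fun x => (h.2 x).imp fun r e => (comp_onArrows φ ψ r).trans e⟩

end LaxAlg

namespace LaxAlgOn

open LaxAlg

variable {X : Type (u + 1)}

/-- The inverse uses preimages on morphisms and the inverse bijections on elements; each of its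
axioms is checked after applying `ψ`, which is injective on elements. -/
theorem exists_iso_of_isOver {A B : LaxAlgOn.{u} X} (ψ : A.toLaxAlg ⟶ B.toLaxAlg)
    (hψ : IsOver ψ) (hb : ColaxHom.IsBijective ψ) (hfull : (ColaxHom.functor ψ).Full)
    (hfaithful : (ColaxHom.functor ψ).Faithful) :
    ∃ e : A.toLaxAlg ≅ B.toLaxAlg, IsOver e.hom := by
  -- The functor is taken apart so that its object map can be replaced by the literal identity,
  -- which avoids all transport below.
  obtain ⟨⟨obj, map, hid, hcomp⟩, cell, h₁, h₂⟩ := ψ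
  obtain rfl : obj = fun x => x := funext hψ
  let ψ : ColaxHom A.toLaxAlg B.toLaxAlg :=
    ⟨⟨fun x => x, map, hid, hcomp⟩, cell, h₁, h₂⟩
  change ColaxHom.IsBijective ψ at hb
  change ψ.functor.Full at hfull
  change ψ.functor.Faithful at hfaithful
  let G : B.toLaxAlg.carrier ⥤ A.toLaxAlg.carrier :=
    { obj := fun x => x
      map := fun {x y} f => @CategoryTheory.Functor.preimage A.toLaxAlg.carrier _ B.toLaxAlg.carrier _
        x y ψ.functor hfull f
      map_id := fun x => ψ.functor.map_injective
        ((ψ.functor.map_preimage _).trans (ψ.functor.map_id x).symm)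
      map_comp := fun f g => ψ.functor.map_injective ((ψ.functor.map_preimage _).trans <| Eq.symm <|
        (ψ.functor.map_comp _ _).trans
          (congrArg₂ _ (ψ.functor.map_preimage _) (ψ.functor.map_preimage _))) }
  have hG : ∀ {x y : B.toLaxAlg.carrier} (f : x ⟶ y), ψ.functor.map (G.map f) = f :=
    fun {x y} f => @CategoryTheory.Functor.map_preimage A.toLaxAlg.carrier _ B.toLaxAlg.carrier _
      ψ.functor hfull x y f
  let m : ∀ {a : B.toLaxAlg.carrier} {p : UltraFamily.{u} B.toLaxAlg.carrier}, B.toLaxAlg.prof.El a p → A.toLaxAlg.prof.El a p :=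
    fun {a p} r => (Equiv.ofBijective _ (hb.elements a p)).symm r
  have hm : ∀ {a : B.toLaxAlg.carrier} {p : UltraFamily.{u} B.toLaxAlg.carrier} (r : B.toLaxAlg.prof.El a p),
      ψ.onArrows (a := a) (p := p) (m r) = r :=
    fun {a p} r => (Equiv.ofBijective _ (hb.elements a p)).apply_symm_apply r
  have inj : ∀ {a : A.toLaxAlg.carrier} {p : UltraFamily.{u} A.toLaxAlg.carrier} {r r' : A.toLaxAlg.prof.El a p},
    ψ.onArrows r = ψ.onArrows r' → r = r' := fun {a p r r'} h => (hb.elements a p).1 h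
  let χ : B.toLaxAlg ⟶ A.toLaxAlg := ColaxHom.ofOnArrows (A := B.toLaxAlg) (B := A.toLaxAlg) G m
    (fun {a a' p} k r => inj <| (hm _).trans <| Eq.symm <| (ψ.onArrows_lact _ _).trans <|
      congrArg₂ B.toLaxAlg.prof.lact (hG k) (hm r))
    (fun {a p q} r g => inj <| (hm _).trans <| Eq.symm <| (ψ.onArrows_ract _ _).trans <|
      congrArg₂ B.toLaxAlg.prof.ract (hm r) (by
        obtain ⟨g, rfl⟩ := UltraFamily.exists_rep g
        exact Germ.mk_eq' fun y => congrArg (Sigma.mk _) (hG (g.val y))))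
    (fun a => inj <| (hm _).trans (ψ.onArrows_unit a).symm)
    (fun {a W P} r s => inj <| (hm _).trans <| Eq.symm <|
      (ψ.onArrows_mult (W := W) (P := P) _ _).trans <|
      congrArg₂ (B.toLaxAlg.multEl (W := W) (P := P)) (hm r) (by
        obtain ⟨s, rfl⟩ := Germ.exists_rep s
        exact Germ.mk_eq' fun y => congrArg (Sigma.mk _) (hm (s.val y))))
  have hχ : ∀ {a : B.toLaxAlg.carrier} {p : UltraFamily.{u} B.toLaxAlg.carrier} (r : B.toLaxAlg.prof.El a p),
      ColaxHom.onArrows (A := B.toLaxAlg) (B := A.toLaxAlg) χ r = m r := fun r =>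
    ColaxHom.onArrows_ofOnArrows (A := B.toLaxAlg) (B := A.toLaxAlg) _ _ _ _ _ _ r
  refine ⟨⟨ψ, χ, ColaxHom.ext_onArrows
    (CategoryTheory.Functor.hext (fun _ => rfl) fun _ _ f => heq_of_eq
      (ψ.functor.map_injective (hG _)))
    fun a p r => heq_of_eq ?_, ColaxHom.ext_onArrows
    (CategoryTheory.Functor.hext (fun _ => rfl) fun _ _ f => heq_of_eq (hG f))
    fun a p r => heq_of_eq ?_⟩, fun _ => rfl⟩
  · refine (comp_onArrows (A := A.toLaxAlg) (B := B.toLaxAlg) (C := A.toLaxAlg) ψ χ r).trans <|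
      Eq.trans ?_ (idHom_onArrows (A := A.toLaxAlg) r).symm
    exact (hχ _).trans (inj (hm _))
  · refine (comp_onArrows (A := B.toLaxAlg) (B := A.toLaxAlg) (C := B.toLaxAlg) χ ψ r).trans <|
      Eq.trans ?_ (idHom_onArrows (A := B.toLaxAlg) r).symm
    exact (congrArg ψ.onArrows (hχ r)).trans (hm r)

end LaxAlgOn

/-! ### Small presheaves -/

namespace IsSmallPresheaf

open Limits

variable {C : Type v} [Category.{u} C] {D : Type v₁} [Category.{u} D]

theorem of_iso {P Q : Cᵒᵖ ⥤ Type u} (e : P ≅ Q) (h : IsSmallPresheaf P) : IsSmallPresheaf Q := by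
  obtain ⟨J, _, F, ⟨i⟩⟩ := h
  exact ⟨J, _, F, ⟨e.symm ≪≫ i⟩⟩

/-- Precomposition with `e.functor` preserves colimits, and by the adjunction it turns the presheaf
represented by `d` into the one represented by `e.inverse.obj d`. -/
theorem of_equivalence (e : C ≌ D) {P : Dᵒᵖ ⥤ Type u} (h : IsSmallPresheaf P) :
    IsSmallPresheaf (e.functor.op ⋙ P) := by
  obtain ⟨J, _, F, ⟨i⟩⟩ := h
  let W := (Functor.whiskeringLeft Cᵒᵖ Dᵒᵖ (Type u)).obj e.functor.op
  refine ⟨J, _, F ⋙ e.inverse, ⟨W.mapIso i ≪≫ preservesColimitIso W (F ⋙ yoneda) ≪≫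
    HasColimit.isoOfNatIso (Functor.isoWhiskerLeft F e.toAdjunction.compYonedaIso.symm)⟩⟩

/-- By density, `P` is the colimit of representables over its category of elements. That category is
locally small and, by Yoneda, has a small set of objects here, so a small model can index the
colimit. -/
theorem of_small (P : Cᵒᵖ ⥤ Type u) [Small.{u} (Σ c : C, P.obj (op c))] : IsSmallPresheaf P := by
  have : Small.{u} (CostructuredArrow yoneda P) :=
    small_of_injective (β := Σ c : C, P.obj (op c))
      (f := fun X => ⟨X.left, yonedaEquiv X.hom⟩) fun X Y h => by
        obtain ⟨c, ⟨⟩, f⟩ := X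
        obtain ⟨d, ⟨⟩, g⟩ := Y
        obtain ⟨h₁, h₂⟩ := Sigma.mk.inj h
        obtain rfl : c = d := h₁
        obtain rfl : f = g := yonedaEquiv.injective (eq_of_heq h₂)
        rfl
  have := essentiallySmall_of_small_of_locallySmall.{u} (CostructuredArrow yoneda P)
  let e := (equivSmallModel.{u} (CostructuredArrow yoneda P)).symm
  refine ⟨SmallModel.{u} (CostructuredArrow yoneda P), inferInstance,
    e.functor ⋙ CostructuredArrow.proj yoneda P, ⟨?_⟩⟩
  exact ((Presheaf.isColimitTautologicalCocone P).whiskerEquivalence e).coconePointUniqueUpToIso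
    (colimit.isColimit ((e.functor ⋙ CostructuredArrow.proj yoneda P) ⋙ yoneda))

/-- Every element of the colimit comes from some morphism `c ⟶ F.obj j`. In a discrete category this
is an identity, so the index set `J` of the diagram already surjects onto the elements. -/
theorem small_of_isDiscrete [IsDiscrete C] {P : Cᵒᵖ ⥤ Type u} (h : IsSmallPresheaf P) :
    Small.{u} (Σ c : C, P.obj (op c)) := by
  obtain ⟨J, _, F, ⟨i⟩⟩ := h
  refine small_of_surjective (α := J)
    (f := fun j => ⟨F.obj j, i.inv.app _ ((colimit.ι (F ⋙ yoneda) j).app _ (𝟙 (F.obj j)))⟩) ?_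
  rintro ⟨c, x⟩
  obtain ⟨j, k, hk⟩ := Types.jointly_surjective_of_isColimit
    (isColimitOfPreserves ((evaluation Cᵒᵖ (Type u)).obj (op c))
      (colimit.isColimit (F ⋙ yoneda))) (i.hom.app (op c) x)
  have k' : c ⟶ F.obj j := k
  obtain rfl : c = F.obj j := IsDiscrete.eq_of_hom k'
  refine ⟨j, congrArg (Sigma.mk _) ?_⟩
  obtain rfl : k = 𝟙 (F.obj j) := Subsingleton.elim (α := (F.obj j ⟶ F.obj j)) _ _
  refine (congrArg (i.inv.app (op (F.obj j))) hk).trans ?_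
  exact i.hom_inv_id_app_apply _ _

end IsSmallPresheaf

/-! ### Smallness of lax algebras -/

namespace LaxAlg

section Smallness

variable {A B : LaxAlg.{u}} (hB : IsNormalized B) {ψ : ColaxHom A B} (hψ : ψ.IsBijective)

/-- The presheaves of elements on points correspond under the extension to points. -/
noncomputable def ptPresheafIso (p : UltraFamily.{u} A.carrier) :
    A.ptPresheaf p ≅ (extendFunctor hB ψ).op ⋙
      B.prof.obj ((UltraFamily.mapFunctor ψ.functor).obj p) :=
  NatIso.ofComponents
    (fun a => (Equiv.ofBijective _ (hψ.elements (show A.carrier from a.unop) p)).toIso)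
    fun {a b} t => by
      ext r
      refine (ψ.onArrows_ptAct t.unop r).trans ?_
      refine Eq.trans ?_ (B.ptAct_unitEl' _ _)
      exact congrArg (B.ptAct · (ψ.onArrows (p := p) r))
        (unitEl_extendFunctor hB ψ t.unop).symm

include hB hψ in
theorem isSmall_iff_isPtSmall : B.IsSmall ↔ A.IsPtSmall := by
  have := extendFunctor_isEquivalence hB hψ
  let e := (extendFunctor hB ψ).asEquivalence
  refine ⟨fun h p => .of_iso (ptPresheafIso hB hψ p).symm (.of_equivalence e (h _)), fun h q => ?_⟩
  -- Surjectivity on objects lifts a family member by member, so every presheaf `B(-, q)` is covered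
  -- by the comparison.
  obtain ⟨p, rfl⟩ : ∃ p, (UltraFamily.mapFunctor ψ.functor).obj p = q := by
    obtain ⟨g, hg⟩ := hψ.obj.2.hasRightInverse
    exact ⟨q.map g, congrArg (UltraFamily.mk q.idx · q.ult) (funext fun x => hg _)⟩
  refine .of_iso ?_ (.of_equivalence e.symm ((h p).of_iso (ptPresheafIso hB hψ p)))
  exact Functor.isoWhiskerRight (NatIso.op e.counitIso).symm
    (B.prof.obj ((UltraFamily.mapFunctor ψ.functor).obj p))

end Smallness

/-- The set of all elements of `A(-, p)` is the same over the carrier and over the points; it is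
small by discreteness, and that suffices over any category. -/
theorem IsDisc.isPtSmall {A : LaxAlg.{u}} (hA : IsDisc A) (h : A.IsSmall) : A.IsPtSmall :=
  fun p => by
    have : IsDiscrete A.carrier := hA
    have := (h p).small_of_isDiscrete
    exact @IsSmallPresheaf.of_small A.Pt _ (A.ptPresheaf p) this

theorem isSmall_of_small (A : LaxAlg.{u}) [Small.{u} A.carrier] : A.IsSmall :=
  fun _ => IsSmallPresheaf.of_small _

/-! ### Full faithfulness of `points` on discrete lax algebras -/

section Discrete

theorem functor_ext_of_isDiscrete {C : Type v} [Category.{w} C] {D : Type v₁} [Category.{w₁} D]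
    [IsDiscrete C] {F G : C ⥤ D} (h : ∀ c, F.obj c = G.obj c) : F = G :=
  CategoryTheory.Functor.ext h fun c d f => by
    obtain rfl := IsDiscrete.eq_of_hom f
    obtain rfl : f = 𝟙 c := Subsingleton.elim _ _
    simp

variable {A B : LaxAlg.{u}} (hA : IsDisc A)

include hA in
theorem pointsFunctor_map_injective {φ ψ : A ⟶ B}
    (h : pointsFunctor.map φ = pointsFunctor.map ψ) : φ = ψ := by
  have : IsDiscrete A.carrier := hA
  refine ColaxHom.ext_onArrows (functor_ext_of_isDiscrete fun c => ?_) fun a p r => ?_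
  · exact CategoryTheory.Functor.congr_obj (congrArg ColaxHom.functor h) c
  · have h' := ColaxHom.onArrows_heq_of_eq (A := A.points) (B := B.points) h (a := a) (p := p) r
    exact (heq_of_eq (ColaxHom.mapPoints_onArrows φ r)).symm.trans
      (h'.trans (heq_of_eq (ColaxHom.mapPoints_onArrows ψ r)))

/-- The functor out of a discrete category with the given action on objects. -/
@[reducible]
def functorOfObj {C : Type v} [Category.{w} C] {D : Type v₁} [Category.{w₁} D]
    (hC : IsDiscrete C) (f : C → D) : C ⥤ D where
  obj := f
  map g := eqToHom (congrArg f (IsDiscrete.eq_of_hom g))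

include hA in
-- For a general `A` a functor between points need not come from one between carriers. With only
-- identities in `A`, the object map of `F` suffices.
theorem map_comparison_of_isDisc (F : A.Pt ⥤ B.Pt) {c d : A.carrier} (k : c ⟶ d) :
    F.map (A.comparison.map k) = B.comparison.map
      ((functorOfObj (D := B.carrier) hA fun a => F.obj a).map k) := by
  have : IsDiscrete A.carrier := hA
  obtain rfl := IsDiscrete.eq_of_hom k
  obtain rfl : k = 𝟙 c := Subsingleton.elim _ _
  exact (congrArg F.map (A.comparison.map_id c)).trans ((F.map_id _).trans
    (B.comparison.map_id _).symm)

/-- The morphism from a discrete lax algebra that induces a given morphism on points. -/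
noncomputable def ofMapPoints (χ : A.points ⟶ B.points) : A ⟶ B :=
  have : IsDiscrete A.carrier := hA
  ColaxHom.ofOnArrows (A := A) (B := B)
    (functorOfObj hA fun a => (ColaxHom.functor χ).obj a)
    (fun {a p} r => ColaxHom.onArrows (A := A.points) (B := B.points) χ (a := a) (p := p) r)
    (fun {a a' p} k r => by
      obtain rfl := IsDiscrete.eq_of_hom k
      obtain rfl : k = 𝟙 a' := Subsingleton.elim _ _
      exact (congrArg _ (A.prof.lact_id r)).trans (B.prof.lact_id _).symm)
    -- This is not vacuous, since `𝛃` of a discrete category still contains reindexings. The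
    -- covariant action is rewritten as `act` along the comparison functor, which `χ` preserves.
    (fun {a p q} r g => by
      refine (congrArg (ColaxHom.onArrows (A := A.points) (B := B.points) χ (a := a) (p := q))
        (A.act_comparison r g).symm).trans ?_
      refine (ColaxHom.onArrows_ract (A := A.points) (B := B.points) χ (a := a) (p := p) (q := q)
        r ((UltraFamily.mapFunctor A.comparison).map g)).trans ?_
      refine Eq.trans ?_ (B.act_comparison
        (ColaxHom.onArrows (A := A.points) (B := B.points) χ (a := a) (p := p) r)
        ((UltraFamily.mapFunctor (functorOfObj (D := B.carrier) hA
          fun a => (ColaxHom.functor χ).obj a)).map g))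
      refine congrArg (B.act (ColaxHom.onArrows (A := A.points) (B := B.points) χ
        (a := a) (p := p) r)) ?_
      obtain ⟨g, rfl⟩ := UltraFamily.exists_rep g
      exact Germ.mk_eq' fun y => congrArg (Sigma.mk _)
        (map_comparison_of_isDisc (B := B) hA
          (ColaxHom.functor (A := A.points) (B := B.points) χ) (g.val y)))
    (fun a => (ColaxHom.onArrows_unit (A := A.points) (B := B.points) χ a))
    (fun {a W P} r s => ColaxHom.onArrows_mult (A := A.points) (B := B.points) χ
      (a := a) (W := W) (P := P) r s)

theorem ofMapPoints_onArrows (χ : A.points ⟶ B.points) {a : A.carrier}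
    {p : UltraFamily.{u} A.carrier} (r : A.prof.El a p) :
    ColaxHom.onArrows (ofMapPoints hA χ) r =
      ColaxHom.onArrows (A := A.points) (B := B.points) χ (a := a) (p := p) r :=
  B.prof.lact_id _

/-- Objects and elements agree by construction. The functors agree on morphisms because a morphism
of points is itself an element, on which `χ` acts as its functor does. -/
theorem map_ofMapPoints (χ : A.points ⟶ B.points) :
    pointsFunctor.map (ofMapPoints hA χ) = χ :=
  ColaxHom.ext_onArrows
    (CategoryTheory.Functor.hext (fun _ => rfl) fun a a' t => heq_of_eq <|
      (ofMapPoints_onArrows hA χ (a := a)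
        (p := (UltraFamily.unit A.carrier).obj a') t).trans
        (ColaxHom.onArrows_unitEl (A := A.points) (B := B.points) χ t))
    fun a p r => heq_of_eq <|
      (ColaxHom.mapPoints_onArrows (ofMapPoints hA χ) (a := a) (p := p) r).trans
        (ofMapPoints_onArrows hA χ (a := a) (p := p) r)

end Discrete

end LaxAlg

/-! ### The equivalence, the bijections on classes, and the theorem -/

namespace LaxAlg

theorem exists_iso_points {X : Type (u + 1)} {A B : LaxAlgOn.{u} X}
    (hB : IsNormalized B.toLaxAlg) (ψ : A.toLaxAlg ⟶ B.toLaxAlg) (hψ : LaxAlgOn.IsOver ψ)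
    (hb : ColaxHom.IsBijective ψ) :
    ∃ e : A.toLaxAlg.points ≅ B.toLaxAlg, ∀ x : X, (ColaxHom.functor e.hom).obj x = x :=
  LaxAlgOn.exists_iso_of_isOver (A := ⟨_, A.toLaxAlg.pointsStr⟩) (B := B)
    (extend hB ψ) hψ (extend_isBijective hB hb) (extendFunctor_full hB hb)
    (extendFunctor_faithful hB hb)

end LaxAlg

open LaxAlg

/-- The functor from discrete to normalized lax algebras. -/
noncomputable def normalization : DiscLaxAlg.{u} ⥤ NormLaxAlg.{u} :=
  IsNormalized.lift (IsDisc.ι ⋙ pointsFunctor) fun D => D.obj.points_isNormalized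

instance : normalization.{u}.Faithful where
  map_injective {D _ f g} h := by
    apply ObjectProperty.hom_ext
    exact pointsFunctor_map_injective D.property (congrArg (fun k => IsNormalized.ι.map k) h)

instance : normalization.{u}.Full where
  map_surjective {D D'} χ := ⟨ObjectProperty.homMk (ofMapPoints D.property χ.hom), by
    apply ObjectProperty.hom_ext
    exact map_ofMapPoints D.property χ.hom⟩

/-- The discretization of a lax algebra on `X`. -/
noncomputable def LaxAlgOn.discretization {X : Type (u + 1)} (N : LaxAlgOn.{u} X) :
    DiscOn.{u} X :=
  ⟨⟨discCat X, N.toLaxAlg.discretization.str⟩, N.toLaxAlg.discretization_isDisc⟩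

/-- The normalized lax algebra on `X` that corresponds to a discrete one. -/
noncomputable def DiscOn.normalization {X : Type (u + 1)} (D : DiscOn.{u} X) : NormOn.{u} X :=
  ⟨⟨inferInstanceAs (Category D.1.toLaxAlg.Pt), D.1.toLaxAlg.pointsStr⟩,
    D.1.toLaxAlg.points_isNormalized⟩

/-- The bijective morphism from the discretization to `N` extends to an isomorphism from its points,
so a normalized lax algebra is recovered from its elements. -/
theorem NormOn.exists_iso_discretization {X : Type (u + 1)} (N : NormOn.{u} X) :
    ∃ e : N.1.discretization.normalization.1.toLaxAlg ≅ N.1.toLaxAlg,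
      LaxAlgOn.IsOver e.hom :=
  exists_iso_points (A := N.1.discretization.1) N.2 N.1.toLaxAlg.ofDiscretization (fun _ => rfl)
    N.1.toLaxAlg.ofDiscretization_isBijective

instance : normalization.{u}.EssSurj where
  mem_essImage N := by
    let N' : NormOn.{u} N.obj.carrier := ⟨⟨N.obj.cat, N.obj.str⟩, N.property⟩
    obtain ⟨e, -⟩ := N'.exists_iso_discretization
    exact ⟨N'.1.discretization.toDiscLaxAlg, ⟨ObjectProperty.isoMk _ e⟩⟩

instance : normalization.{u}.IsEquivalence where

/-- The normalization on isomorphism classes. -/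
noncomputable def DiscClass.normalization {X : Type (u + 1)} :
    DiscClass.{u} X → NormClass.{u} X :=
  Quotient.map DiscOn.normalization fun _ _ ⟨e, h⟩ => ⟨pointsFunctor.mapIso e, h⟩

theorem DiscClass.normalization_bijective (X : Type (u + 1)) :
    Function.Bijective (DiscClass.normalization (X := X)) := by
  constructor
  · intro D D' h
    induction D using Quotient.inductionOn with | _ D
    induction D' using Quotient.inductionOn with | _ D'
    change DiscOn.{u} X at D D'
    obtain ⟨e, he⟩ := Quotient.exact h
    -- The lifted isomorphism is again over `X`, since `points` does not change the object map of a
    -- morphism.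
    let i : D.toDiscLaxAlg ≅ D'.toDiscLaxAlg :=
      _root_.normalization.preimageIso (ObjectProperty.isoMk _ e)
    refine Quotient.sound ⟨IsDisc.ι.mapIso i, fun x => ?_⟩
    refine Eq.trans ?_ (he x)
    have hi : _root_.normalization.map i.hom = ObjectProperty.homMk e.hom :=
      _root_.normalization.map_preimage _
    exact congrArg (fun χ : _root_.normalization.obj D.toDiscLaxAlg ⟶
      _root_.normalization.obj D'.toDiscLaxAlg => (ColaxHom.functor χ.hom).obj x) hi
  · intro N
    induction N using Quotient.inductionOn with | _ N
    change NormOn.{u} X at N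
    exact ⟨N.1.discretization.toClass, Quotient.sound N.exists_iso_discretization⟩

theorem mainTheorem11 :
    ∃ (b : ∀ X : Type (u + 1), DiscClass.{u} X ≃ NormClass.{u} X)
      (E : DiscLaxAlg.{u} ≌ NormLaxAlg.{u})
      (φ : LaxAlg.IsDisc.{u}.ι ⟶ E.functor ⋙ LaxAlg.IsNormalized.{u}.ι),
      (∀ (X : Type (u + 1)) (D : DiscOn.{u} X) (N : NormOn.{u} X),
        b X D.toClass = N.toClass ↔
          ∃ ψ : D.1.toLaxAlg ⟶ N.1.toLaxAlg,
            LaxAlgOn.IsOver ψ ∧ LaxAlg.ColaxHom.IsBijective ψ) ∧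
      (∀ (X : Type (u + 1)) (D : DiscOn.{u} X), ∃ N : NormOn.{u} X,
        E.functor.obj D.toDiscLaxAlg = N.toNormLaxAlg ∧ b X D.toClass = N.toClass) ∧
      (∀ D : DiscLaxAlg.{u}, LaxAlg.ColaxHom.IsBijective (φ.app D)) ∧
      (∀ (D : DiscLaxAlg.{u}) (N : NormLaxAlg.{u}) (ψ : D.obj ⟶ N.obj),
        LaxAlg.ColaxHom.IsBijective ψ →
          (N.obj.IsSmall ↔ D.obj.IsPtSmall) ∧ (D.obj.IsSmall → N.obj.IsSmall) ∧
            (Small.{u} D.obj.carrier → D.obj.IsSmall)) := by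
  -- Equivalence, bijections and natural morphism all come from `points`, so the compatibility of
  -- `E` with `b` holds by `rfl`.
  refine ⟨fun X => Equiv.ofBijective _ (DiscClass.normalization_bijective X),
    normalization.asEquivalence, Functor.whiskerLeft IsDisc.ι toPointsNat,
    fun X D N => ⟨fun h => ?_, fun ⟨ψ, h, hb⟩ => ?_⟩,
    fun X D => ⟨D.normalization, rfl, rfl⟩, fun D => D.obj.toPoints_isBijective,
    fun D N ψ hψ => ⟨isSmall_iff_isPtSmall N.property hψ, fun h =>
      (isSmall_iff_isPtSmall N.property hψ).2 (IsDisc.isPtSmall D.property h),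
      fun _ => D.obj.isSmall_of_small⟩⟩
  · obtain ⟨e, he⟩ := Quotient.exact h
    -- `toPoints` is the identity on objects, so the composite is over `X` for the same reason as
    -- `e`.
    exact ⟨D.1.toLaxAlg.toPoints ≫ e.hom, he,
      IsBijective.comp D.1.toLaxAlg.toPoints_isBijective (isBijective_of_iso e)⟩
  · exact Quotient.sound (exists_iso_points N.2 ψ h hb)
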